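/- **Notation.** Let $k\ge 1$, $n_1,\dots,n_k\ge 1$, and let $\mathbb F_{n_i}^+$ be the free semigroup with unit $g_0^i$ on $n_i$ generators $g^i_1,\dots,g^i_{n_i}$; $|\alpha|$ is the length of a word $\alpha$. Let $F^2(H_{n_i})$ be the full Fock space with orthonormal basis $\{e^i_\alpha\}_{\alpha\in\mathbb F_{n_i}^+}$, $F:=\bigotimes_{i=1}^kF^2(H_{n_i})$, $e_{\gamma}:=e^1_{\gamma_1}\otimes\cdots\otimes e^k_{\gamma_k}$ for $\gamma\in\mathbf F:=\mathbb F^+_{n_1}\times\cdots\times\mathbb F^+_{n_k}$, and let $\mathbf S_{i,j},\mathbf R_{i,j}\in B(F)$ be the left and right creation operators, which replace the $i$-th word $\gamma_i$ of $e_\gamma$ by $g^i_j\gamma_i$, resp. $\gamma_ig^i_j$. For a tuple $\mathbf X=(X_{i,j})$ put $X_{i,\alpha}:=X_{i,j_1}\cdots X_{i,j_p}$ if $\alpha=g^i_{j_1}\cdots g^i_{j_p}$. Let $\mathcal E$ be a complex Hilbert space. $A\in B(\mathcal E\otimes F)$ is *$k$-multi-Toeplitz* if $(I_{\mathcal E}\otimes\mathbf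 R_{i,s}^*)A(I_{\mathcal E}\otimes\mathbf R_{i,t})=\delta_{st}A$ for all $i$ and all $s,t\in\{1,\dots,n_i\}$. An *index* is a pair $(\alpha;\beta)\in\mathbf F\times\mathbf F$ such that, for some $m\in\mathbb Z^k$, $|\alpha_i|=m_i^-$ and $|\beta_i|=m_i^+$ for all $i$. The Fourier coefficients of $A$ are the operators $A_{(\alpha;\beta)}\in B(\mathcal E)$ with $\langle A_{(\alpha;\beta)}h,\ell\rangle=\langle A(h\otimes e_\beta),\ell\otimes e_\alpha\rangle$, where $(\alpha;\beta)$ is an index. For a family $\{A_{(\alpha;\beta)}\}\subset B(\mathcal E)$ over all indices and $r\in[0,1]$, consider the series $$\varphi(r\mathbf S)=\sum_{m_1\in\mathbb Z}\cdots\sum_{m_k\in\mathbb Z}\ \sum_{|\alpha_i|=m_i^-,\,|\beta_i|=m_i^+}A_{(\alpha;\beta)}\otimes r^{\sum_i(|\alpha_i|+|\beta_i|)}\,\mathbf S_{1,\alpha_1}\cdots\mathbf S_{k,\alpha_k}\mathbf S_{1,\beta_1}^*\cdots\mathbf S_{k,\beta_k}^*,$$ where a series over $\mathbb Z$ is called convergent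 if its parts over $m<0$ and over $m\ge0$ converge. We say that $\varphi(\mathbf S)$ is the formal Fourier series of $A$ if the $A_{(\alpha;\beta)}$ are the Fourier coefficients of $A$. $\mathcal P$ is the linear span of all $h\otimes e_\omega$ ($h\in\mathcal E$, $\omega\in\mathbf F$), and $\boldsymbol{\mathcal A}_{\mathbf n}$ is the norm closed algebra generated by the $\mathbf S_{i,j}$ and $I$. For words, $\gamma<_r\omega$ means $\omega=\sigma\gamma$ with $\sigma\neq g_0$, and then $\omega\backslash_r\gamma:=\sigma$; $\omega\sim_{rc}\gamma$ in $\mathbf F$ means that for each $i$, $\omega_i<_r\gamma_i$, $\gamma_i<_r\omega_i$ or $\omega_i=\gamma_i$; in that case $c^+(\omega,\gamma)_i$ is $\omega_i\backslash_r\gamma_i$ if $\gamma_i<_r\omega_i$ and $g_0^i$ otherwise, and $c^-(\omega,\gamma):=c^+(\gamma,\omega)$. For $r\in[0,1)$ let $\boldsymbol\Delta_r:=(\mathrm{id}-\Phi_1)\circ\cdots\circ(\mathrm{id}-\Phi_k)(I)$ with $\Phi_i(Y)=r^2\sum_j\mathbf S_{i,j}Y\mathbf S_{i,j}^*$; the Berezin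 kernel is $\mathbf K_{r\mathbf S}x:=\sum_{\beta\in\mathbf F}e_\beta\otimes\boldsymbol\Delta_r^{1/2}(r\mathbf S)_{1,\beta_1}^*\cdots(r\mathbf S)_{k,\beta_k}^*x$, and $\boldsymbol{\mathcal B}^{ext}_{r\mathbf S}[u]:=(I_{\mathcal E}\otimes\mathbf K_{r\mathbf S}^*)(u\otimes I_F)(I_{\mathcal E}\otimes\mathbf K_{r\mathbf S})$ for $u\in B(\mathcal E\otimes F)$. **Theorem.** (1) Let $\{A_{(\alpha;\beta)}\}$ be a family of operators in $B(\mathcal E)$ over all indices. Then $\varphi(\mathbf S)$ is the formal Fourier series of a $k$-multi-Toeplitz operator on $\mathcal E\otimes F$ if and only if the series $\varphi(r\mathbf S)$ converges in the operator norm for every $r\in[0,1)$ and $\sup_{r\in[0,1)}\|\varphi(r\mathbf S)\|<\infty$. (2) Equivalently: (i) for each $\gamma\in\mathbf F$ the series $\sum_{\omega\sim_{rc}\gamma}A_{(c^+(\omega,\gamma);c^-(\omega,\gamma))}^*A_{(c^+(\omega,\gamma);c^-(\omega,\gamma))}$ is WOT-convergent, and (ii) $\sup_{r\in[0,1)}\sup_{p\in\mathcal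 P,\|p\|\le1}\|\varphi(r\mathbf S)p\|<\infty$. Here condition (i) alone implies that the vector series $\varphi(r\mathbf S)p$ converges for all $p\in\mathcal P$ and $r\in[0,1]$. (3) If $A$ is a $k$-multi-Toeplitz operator with formal Fourier series $\varphi(\mathbf S)$, then for every $r\in[0,1)$ the series $\varphi(r\mathbf S)$ converges in the operator norm, its sum over $m\in\mathbb Z^k$ does not depend on the order of summation, it lies in the norm closure of $\operatorname{span}\{f^*g: f,g\in B(\mathcal E)\otimes_{min}\boldsymbol{\mathcal A}_{\mathbf n}\}$, $\mathbf K_{r\mathbf S}$ is a well-defined bounded operator, and $\varphi(r\mathbf S)=\boldsymbol{\mathcal B}^{ext}_{r\mathbf S}[A]$. Moreover $A=\text{SOT-}\lim_{r\to1}\varphi(r\mathbf S)$, $Aq=\varphi(\mathbf S)q$ for all $q\in\mathcal P$, and $$\|A\|=\sup_{r\in[0,1)}\|\varphi(r\mathbf S)\|=\lim_{r\to1}\|\varphi(r\mathbf S)\|=\sup_{q\in\mathcal P,\,\|q\|\le1}\|\varphi(\mathbf S)q\|.$$ (4) Two $k$-multi-Toeplitz operators on $\mathcal E\otimes F$ are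 equal if and only if their Fourier coefficients are equal. -/

import Mathlib

open scoped TensorProduct InnerProductSpace

noncomputable section

namespace Polyball

/-! ### Hilbert space tensor products -/

section HilbertTensor

variable {E F G H : Type*}
  [NormedAddCommGroup E] [InnerProductSpace ℂ E] [NormedAddCommGroup F] [InnerProductSpace ℂ F]
  [NormedAddCommGroup G] [InnerProductSpace ℂ G] [NormedAddCommGroup H] [InnerProductSpace ℂ H]

/-- The Hilbert space tensor product: the completion of the algebraic tensor product with respect
to the inner product determined by `⟪x ⊗ y, x' ⊗ y'⟫ = ⟪x, x'⟫ ⟪y, y'⟫`. -/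
def HTensor (E F : Type*) [NormedAddCommGroup E] [InnerProductSpace ℂ E]
    [NormedAddCommGroup F] [InnerProductSpace ℂ F] : Type _ :=
  UniformSpace.Completion (E ⊗[ℂ] F)

instance : NormedAddCommGroup (HTensor E F) :=
  inferInstanceAs (NormedAddCommGroup (UniformSpace.Completion (E ⊗[ℂ] F)))

instance : InnerProductSpace ℂ (HTensor E F) :=
  inferInstanceAs (InnerProductSpace ℂ (UniformSpace.Completion (E ⊗[ℂ] F)))

instance : CompleteSpace (HTensor E F) :=
  inferInstanceAs (CompleteSpace (UniformSpace.Completion (E ⊗[ℂ] F)))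

/-- The embedding of the algebraic tensor product into the Hilbert space tensor product. -/
def incl (E F : Type*) [NormedAddCommGroup E] [InnerProductSpace ℂ E]
    [NormedAddCommGroup F] [InnerProductSpace ℂ F] : E ⊗[ℂ] F →ₗᵢ[ℂ] HTensor E F :=
  UniformSpace.Completion.toComplₗᵢ (𝕜 := ℂ) (E := E ⊗[ℂ] F)

theorem denseRange_incl : DenseRange (incl E F) :=
  UniformSpace.Completion.denseRange_coe (α := E ⊗[ℂ] F)

/-- The elementary tensor `x ⊗ y`. -/
def tmul (x : E) (y : F) : HTensor E F := incl E F (x ⊗ₜ[ℂ] y)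

/-- The bounded operator `x ↦ x ⊗ y`. -/
def tmulRight (E : Type*) [NormedAddCommGroup E] [InnerProductSpace ℂ E] (y : F) :
    E →L[ℂ] HTensor E F :=
  (incl E F).toContinuousLinearMap ∘L (TensorProduct.mkL ℂ E F).flip y

theorem tmulRight_apply (x : E) (y : F) : tmulRight E y x = tmul x y := rfl

/-- The tensor product `f ⊗ g` of bounded operators. -/
def tmap (f : E →L[ℂ] G) (g : F →L[ℂ] H) : HTensor E F →L[ℂ] HTensor G H :=
  ((incl G H).toContinuousLinearMap ∘L TensorProduct.mapL f g).extend
    (incl E F).toContinuousLinearMap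

theorem tmap_incl (f : E →L[ℂ] G) (g : F →L[ℂ] H) (x : E ⊗[ℂ] F) :
    tmap f g (incl E F x) = incl G H (TensorProduct.mapL f g x) :=
  ContinuousLinearMap.extend_eq _ (e := (incl E F).toContinuousLinearMap)
    denseRange_incl (incl E F).isometry.isUniformInducing x

theorem tmap_tmul (f : E →L[ℂ] G) (g : F →L[ℂ] H) (x : E) (y : F) :
    tmap f g (tmul x y) = tmul (f x) (g y) := by
  simp only [tmul, tmap_incl, TensorProduct.mapL_tmul]

theorem inner_tmul (x x' : E) (y y' : F) :
    ⟪tmul x y, tmul x' y'⟫_ℂ = ⟪x, x'⟫_ℂ * ⟪y, y'⟫_ℂ := by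
  simp [tmul]

theorem norm_tmul (x : E) (y : F) : ‖tmul x y‖ = ‖x‖ * ‖y‖ := by
  simp [tmul]

/-- The isometric map `(E ⊗ F) ⊗ G → (E ⊗̂ F) ⊗̂ G` from the algebraic tensor product. -/
def inclLeft (E F G : Type*) [NormedAddCommGroup E] [InnerProductSpace ℂ E]
    [NormedAddCommGroup F] [InnerProductSpace ℂ F] [NormedAddCommGroup G]
    [InnerProductSpace ℂ G] : (E ⊗[ℂ] F) ⊗[ℂ] G →ₗᵢ[ℂ] HTensor (HTensor E F) G :=
  (incl (HTensor E F) G).comp (TensorProduct.mapIsometry (incl E F) LinearIsometry.id)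

/-- The isometric map `E ⊗ (F ⊗ G) → E ⊗̂ (F ⊗̂ G)` from the algebraic tensor product. -/
def inclRight (E F G : Type*) [NormedAddCommGroup E] [InnerProductSpace ℂ E]
    [NormedAddCommGroup F] [InnerProductSpace ℂ F] [NormedAddCommGroup G]
    [InnerProductSpace ℂ G] : E ⊗[ℂ] (F ⊗[ℂ] G) →ₗᵢ[ℂ] HTensor E (HTensor F G) :=
  (incl E (HTensor F G)).comp (TensorProduct.mapIsometry LinearIsometry.id (incl F G))

theorem denseRange_inclLeft : DenseRange (inclLeft E F G) := by
  set j := TensorProduct.mapIsometry (incl E F) (LinearIsometry.id (R := ℂ) (E := G)) with hj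
  have key : DenseRange j := by
    intro z
    have hcl : closure (Set.range j)
        = ((LinearMap.range j.toLinearMap).topologicalClosure : Set ((HTensor E F) ⊗[ℂ] G)) := by
      rw [Submodule.topologicalClosure_coe]; rfl
    rw [hcl, SetLike.mem_coe]
    induction z using TensorProduct.induction_on with
    | zero => exact Submodule.zero_mem _
    | add a b ha hb => exact Submodule.add_mem _ ha hb
    | tmul u g =>
      refine denseRange_incl.induction_on
        (p := fun u => u ⊗ₜ[ℂ] g ∈ (LinearMap.range j.toLinearMap).topologicalClosure) u ?_ ?_
      · exact (Submodule.isClosed_topologicalClosure _).preimage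
          ((TensorProduct.mkL ℂ (HTensor E F) G).flip g).continuous
      · intro a
        exact Submodule.le_topologicalClosure _ ⟨a ⊗ₜ g, by simp [hj]⟩
  exact denseRange_incl.comp key (incl (HTensor E F) G).continuous

theorem denseRange_inclRight : DenseRange (inclRight E F G) := by
  set j := TensorProduct.mapIsometry (LinearIsometry.id (R := ℂ) (E := E)) (incl F G) with hj
  have key : DenseRange j := by
    intro z
    have hcl : closure (Set.range j)
        = ((LinearMap.range j.toLinearMap).topologicalClosure : Set (E ⊗[ℂ] (HTensor F G))) := by
      rw [Submodule.topologicalClosure_coe]; rfl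
    rw [hcl, SetLike.mem_coe]
    induction z using TensorProduct.induction_on with
    | zero => exact Submodule.zero_mem _
    | add a b ha hb => exact Submodule.add_mem _ ha hb
    | tmul e u =>
      refine denseRange_incl.induction_on
        (p := fun u => e ⊗ₜ[ℂ] u ∈ (LinearMap.range j.toLinearMap).topologicalClosure) u ?_ ?_
      · exact (Submodule.isClosed_topologicalClosure _).preimage
          (TensorProduct.mkL ℂ E (HTensor F G) e).continuous
      · intro a
        exact Submodule.le_topologicalClosure _ ⟨e ⊗ₜ a, by simp [hj]⟩
  exact denseRange_incl.comp key (incl E (HTensor F G)).continuous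

theorem norm_inclRight_assoc (x : (E ⊗[ℂ] F) ⊗[ℂ] G) :
    ‖(inclRight E F G).toLinearMap (TensorProduct.assoc ℂ E F G x)‖
      = ‖(inclLeft E F G).toLinearMap x‖ := by
  rw [LinearIsometry.coe_toLinearMap, LinearIsometry.coe_toLinearMap, LinearIsometry.norm_map,
    LinearIsometry.norm_map, TensorProduct.norm_assoc]

/-- The canonical unitary `(E ⊗ F) ⊗ G ≃ E ⊗ (F ⊗ G)`. -/
def tassoc (E F G : Type*) [NormedAddCommGroup E] [InnerProductSpace ℂ E]
    [NormedAddCommGroup F] [InnerProductSpace ℂ F] [NormedAddCommGroup G]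
    [InnerProductSpace ℂ G] : HTensor (HTensor E F) G ≃ₗᵢ[ℂ] HTensor E (HTensor F G) :=
  (TensorProduct.assoc ℂ E F G).extendOfIsometry
    (inclLeft E F G).toLinearMap (inclRight E F G).toLinearMap
    denseRange_inclLeft denseRange_inclRight norm_inclRight_assoc

theorem tassoc_tmul (x : E) (y : F) (z : G) :
    tassoc E F G (tmul (tmul x y) z) = tmul x (tmul y z) :=
  LinearEquiv.extendOfIsometry_eq (f := TensorProduct.assoc ℂ E F G)
    (e₁ := (inclLeft E F G).toLinearMap) (e₂ := (inclRight E F G).toLinearMap)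
    denseRange_inclLeft denseRange_inclRight norm_inclRight_assoc ((x ⊗ₜ y) ⊗ₜ z)

end HilbertTensor

/-! ### Words, Fock spaces and creation operators -/

section Fock

variable {k : ℕ} {n : Fin k → ℕ}

/-- The direct product `𝔽⁺_{n₁} × ⋯ × 𝔽⁺_{n_k}` of free semigroups with unit. -/
abbrev Words (n : Fin k → ℕ) : Type := (i : Fin k) → FreeMonoid (Fin (n i))

/-- The tensor product `F²(H_{n₁}) ⊗ ⋯ ⊗ F²(H_{n_k})` of full Fock spaces. The full Fock space on
`n` generators has the orthonormal basis `e_α`, `α ∈ 𝔽⁺_n`, so that the tensor product is the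
Hilbert space with orthonormal basis `e_{γ₁} ⊗ ⋯ ⊗ e_{γ_k}`, where `γ` runs over all `k`-tuples of
words. -/
abbrev Fock (n : Fin k → ℕ) : Type := lp (fun _ : Words n => ℂ) 2

/-- The basis vector `e_γ = e_{γ₁} ⊗ ⋯ ⊗ e_{γ_k}`. -/
def basisVec (γ : Words n) : Fock n := by
  classical exact lp.single 2 γ (1 : ℂ)

theorem orthonormal_basisVec : Orthonormal ℂ (basisVec : Words n → Fock n) := by
  classical
  rw [orthonormal_iff_ite]
  intro γ ω
  simp only [basisVec]
  rw [lp.inner_single_left]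
  by_cases h : γ = ω
  · subst h; simp
  · simp [h]

/-- The isometry of the Fock space that sends `e_γ` to `e_{f γ}`, for an injective map `f`. -/
def wordIsometry (f : Words n → Words n) (hf : Function.Injective f) : Fock n →ₗᵢ[ℂ] Fock n :=
  ((orthonormal_basisVec (n := n)).comp f hf).orthogonalFamily.linearIsometry

theorem wordIsometry_basisVec (f : Words n → Words n) (hf : Function.Injective f) (γ : Words n) :
    wordIsometry f hf (basisVec γ) = basisVec (f γ) := by
  classical
  simp only [wordIsometry, basisVec]
  rw [OrthogonalFamily.linearIsometry_apply_single]
  simp [basisVec]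

/-- Multiplication of the `i`-th word by the generator `j` from the left. -/
def consLeft (i : Fin k) (j : Fin (n i)) (γ : Words n) : Words n :=
  Function.update γ i (FreeMonoid.of j * γ i)

/-- Multiplication of the `i`-th word by the generator `j` from the right. -/
def consRight (i : Fin k) (j : Fin (n i)) (γ : Words n) : Words n :=
  Function.update γ i (γ i * FreeMonoid.of j)

theorem consLeft_injective (i : Fin k) (j : Fin (n i)) :
    Function.Injective (consLeft (n := n) i j) := by
  intro γ ω h
  funext l
  have hl := congrFun h l
  by_cases hli : l = i
  · subst hli
    simpa [consLeft] using hl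
  · simpa [consLeft, hli] using hl

theorem consRight_injective (i : Fin k) (j : Fin (n i)) :
    Function.Injective (consRight (n := n) i j) := by
  intro γ ω h
  funext l
  have hl := congrFun h l
  by_cases hli : l = i
  · subst hli
    simpa [consRight] using hl
  · simpa [consRight, hli] using hl

/-- The left creation operator `𝐒_{i,j} = I ⊗ ⋯ ⊗ S_{i,j} ⊗ ⋯ ⊗ I`. -/
def leftCreation (i : Fin k) (j : Fin (n i)) : Fock n →L[ℂ] Fock n :=
  (wordIsometry (consLeft i j) (consLeft_injective i j)).toContinuousLinearMap

/-- The right creation operator `𝐑_{i,j} = I ⊗ ⋯ ⊗ R_{i,j} ⊗ ⋯ ⊗ I`. -/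
def rightCreation (i : Fin k) (j : Fin (n i)) : Fock n →L[ℂ] Fock n :=
  (wordIsometry (consRight i j) (consRight_injective i j)).toContinuousLinearMap

theorem leftCreation_basisVec (i : Fin k) (j : Fin (n i)) (γ : Words n) :
    leftCreation i j (basisVec γ) = basisVec (consLeft i j γ) :=
  wordIsometry_basisVec _ (consLeft_injective i j) γ

theorem rightCreation_basisVec (i : Fin k) (j : Fin (n i)) (γ : Words n) :
    rightCreation i j (basisVec γ) = basisVec (consRight i j γ) :=
  wordIsometry_basisVec _ (consRight_injective i j) γ

end Fock

/-! ### Tuples of operators, the defect operator and the Berezin kernel -/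

section Berezin

variable {k : ℕ} {n : Fin k → ℕ}
variable {H : Type*} [NormedAddCommGroup H] [InnerProductSpace ℂ H] [CompleteSpace H]

/-- A `k`-tuple `X = (X₁, …, X_k)` of `n_i`-tuples of bounded operators on `H`. -/
abbrev OpTuple (n : Fin k → ℕ) (H : Type*) [NormedAddCommGroup H] [InnerProductSpace ℂ H] : Type _ :=
  (i : Fin k) → Fin (n i) → (H →L[ℂ] H)

/-- `X_α = X_{1,α₁} ⋯ X_{k,α_k}`. -/
def wordOp (X : OpTuple n H) (α : Words n) : H →L[ℂ] H :=
  (List.ofFn fun i => FreeMonoid.lift (X i) (α i)).prod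

/-- `X_{1,β₁}^* ⋯ X_{k,β_k}^*`. -/
def wordOpStar (X : OpTuple n H) (β : Words n) : H →L[ℂ] H :=
  (List.ofFn fun i => ContinuousLinearMap.adjoint (FreeMonoid.lift (X i) (β i))).prod

/-- `Φ_{X_i}(Y) = ∑_j X_{i,j} Y X_{i,j}^*`. -/
def cpMap (X : OpTuple n H) (i : Fin k) : Module.End ℂ (H →L[ℂ] H) :=
  ∑ j, LinearMap.mulLeftRight ℂ (X i j, ContinuousLinearMap.adjoint (X i j))

/-- The defect operator `Δ_X(I)`, where `Δ_X = (id - Φ_{X₁}) ∘ ⋯ ∘ (id - Φ_{X_k})`. -/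
def defect (X : OpTuple n H) : H →L[ℂ] H :=
  (List.ofFn fun i => (1 - cpMap X i : Module.End ℂ (H →L[ℂ] H))).prod 1

/-- `K` is the noncommutative Berezin kernel `K_X`, that is
`K h = ∑_β e_β ⊗ Δ_X(I)^{1/2} X_{1,β₁}^* ⋯ X_{k,β_k}^* h` for all `h`. The second tensor factor,
the closure of the range of `Δ_X(I)`, is regarded as a subspace of `H`. -/
def IsBerezinKernel (X : OpTuple n H) (K : H →L[ℂ] HTensor (Fock n) H) : Prop :=
  ∀ h : H, HasSum
    (fun β : Words n => tmul (basisVec β) (CFC.sqrt (defect X) (wordOpStar X β h))) (K h)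

/-- The extended Berezin transform `u ↦ (I_E ⊗ K^*) (u ⊗ I) (I_E ⊗ K)` with kernel `K`. -/
def berezinExt {E : Type*} [NormedAddCommGroup E] [InnerProductSpace ℂ E] [CompleteSpace E]
    (K : H →L[ℂ] HTensor (Fock n) H) (u : HTensor E (Fock n) →L[ℂ] HTensor E (Fock n)) :
    HTensor E H →L[ℂ] HTensor E H :=
  tmap (ContinuousLinearMap.id ℂ E) (ContinuousLinearMap.adjoint K) ∘L
    (tassoc E (Fock n) H).toContinuousLinearEquiv.toContinuousLinearMap ∘L
    tmap u (ContinuousLinearMap.id ℂ H) ∘L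
    (tassoc E (Fock n) H).symm.toContinuousLinearEquiv.toContinuousLinearMap ∘L
    tmap (ContinuousLinearMap.id ℂ E) K

/-- The tuple `r𝐒 = (r𝐒_{i,j})`. -/
def scaledShift (n : Fin k → ℕ) (r : ℝ) : OpTuple n (Fock n) :=
  fun i j => (r : ℂ) • leftCreation i j

end Berezin

/-! ### Iterated series over `ℤ^k` -/

section Series

variable {V : Type*} [AddCommGroup V] [TopologicalSpace V]

/-- `∑_{m ∈ ℤ} f m = s`: the series over `m < 0` and over `m ≥ 0` both converge and their sums add
up to `s`. -/
def HasTwoSidedSum (f : ℤ → V) (s : V) : Prop :=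
  ∃ s₁ s₂ : V,
    Filter.Tendsto (fun N : ℕ => ∑ p ∈ Finset.range N, f (-((p : ℤ) + 1))) Filter.atTop (nhds s₁) ∧
    Filter.Tendsto (fun N : ℕ => ∑ p ∈ Finset.range N, f (p : ℤ)) Filter.atTop (nhds s₂) ∧
    s = s₁ + s₂

/-- `∑_{m₁ ∈ ℤ} ⋯ ∑_{m_k ∈ ℤ} f (m₁, …, m_k) = s` as an iterated series. -/
def HasIterSum : {k : ℕ} → ((Fin k → ℤ) → V) → V → Prop
  | 0, f, s => f Fin.elim0 = s
  | _ + 1, f, s => ∃ g : ℤ → V,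
      (∀ m₁ : ℤ, HasIterSum (fun m => f (Fin.cons m₁ m)) (g m₁)) ∧ HasTwoSidedSum g s

end Series

/-! ### Comparable words -/

section Comparable

variable {k : ℕ} {n : Fin k → ℕ}

/-- `γ <_r ω`: there is `σ ≠ g₀` with `ω = σ γ`. -/
def RightLT {ι : Type*} (γ ω : FreeMonoid ι) : Prop := ∃ σ : FreeMonoid ι, σ ≠ 1 ∧ ω = σ * γ

open Classical in
/-- `c_r^+(ω, γ)`: the word `ω \_r γ`, i.e. the `σ` with `ω = σ γ`, if `γ <_r ω`, and `g₀`
otherwise. -/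
def cPlus {ι : Type*} (ω γ : FreeMonoid ι) : FreeMonoid ι :=
  if h : RightLT γ ω then h.choose else 1

/-- `c_r^-(ω, γ) = c_r^+(γ, ω)`: the word `γ \_r ω` if `ω <_r γ`, and `g₀` otherwise. -/
def cMinus {ι : Type*} (ω γ : FreeMonoid ι) : FreeMonoid ι := cPlus γ ω

/-- `ω ∼_rc γ` for `k`-tuples of words. -/
def RightComparable (ω γ : Words n) : Prop :=
  ∀ i, RightLT (ω i) (γ i) ∨ RightLT (γ i) (ω i) ∨ ω i = γ i

end Comparable

/-! ### Multi-Toeplitz operators and formal Fourier series -/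

section Toeplitz

variable {k : ℕ} {n : Fin k → ℕ}
variable {E : Type*} [NormedAddCommGroup E] [InnerProductSpace ℂ E] [CompleteSpace E]

/-- `k`-multi-Toeplitz operators on `E ⊗ F²(H_{n₁}) ⊗ ⋯ ⊗ F²(H_{n_k})`. -/
def IsMultiToeplitz (A : HTensor E (Fock n) →L[ℂ] HTensor E (Fock n)) : Prop :=
  ∀ (i : Fin k) (s t : Fin (n i)),
    tmap (ContinuousLinearMap.id ℂ E) (ContinuousLinearMap.adjoint (rightCreation i s)) ∘L A ∘L
      tmap (ContinuousLinearMap.id ℂ E) (rightCreation i t) = if s = t then A else 0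

/-- `|α_i| = m_i^-` and `|β_i| = m_i^+` for all `i`. -/
def HasDegree (m : Fin k → ℤ) (α β : Words n) : Prop :=
  ∀ i, ((α i).length : ℤ) = max (-(m i)) 0 ∧ ((β i).length : ℤ) = max (m i) 0

/-- The pairs `(α; β)` that index the coefficients of a formal Fourier series. -/
def IsIndex (α β : Words n) : Prop := ∃ m : Fin k → ℤ, HasDegree m α β

theorem finite_words_length_eq (p : Fin k → ℤ) :
    {α : Words n | ∀ i, ((α i).length : ℤ) = p i}.Finite := by
  have h : ∀ i, {w : FreeMonoid (Fin (n i)) | (w.length : ℤ) = p i}.Finite := by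
    intro i
    refine (List.finite_length_eq (Fin (n i)) (p i).toNat).subset ?_
    intro w hw
    have hw' : (w.length : ℤ) = p i := hw
    change w.length = (p i).toNat
    omega
  exact (Set.Finite.pi' h)

theorem finite_hasDegree (m : Fin k → ℤ) :
    {q : Words n × Words n | HasDegree m q.1 q.2}.Finite := by
  refine ((finite_words_length_eq (n := n) fun i => max (-(m i)) 0).prod
    (finite_words_length_eq (n := n) fun i => max (m i) 0)).subset ?_
  intro q hq
  exact ⟨fun i => (hq i).1, fun i => (hq i).2⟩

/-- The block
`∑ A_{(α;β)} ⊗ r^{∑ (|α_i| + |β_i|)} 𝐒_{1,α₁} ⋯ 𝐒_{k,α_k} 𝐒_{1,β₁}^* ⋯ 𝐒_{k,β_k}^*` of the formal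
series `φ(r𝐒)`, the finite sum running over all `(α; β)` with `|α_i| = m_i^-`, `|β_i| = m_i^+`.
Only the values of `a` at such pairs matter. -/
def block (a : Words n → Words n → E →L[ℂ] E) (r : ℝ) (m : Fin k → ℤ) :
    HTensor E (Fock n) →L[ℂ] HTensor E (Fock n) :=
  ∑ q ∈ (finite_hasDegree m).toFinset,
    tmap (a q.1 q.2)
      ((r : ℂ) ^ (∑ i, ((q.1 i).length + (q.2 i).length)) •
        (wordOp leftCreation q.1 ∘L wordOpStar leftCreation q.2))

/-- The Fourier coefficient `A_{(α;β)}`, given by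
`⟨A_{(α;β)} h, ℓ⟩ = ⟨A (h ⊗ e_β), ℓ ⊗ e_α⟩`. For an index `(α; β)` one has, for every `i`, either
`α_i = g₀` or `β_i = g₀`. -/
def fourierCoeff (A : HTensor E (Fock n) →L[ℂ] HTensor E (Fock n)) (α β : Words n) : E →L[ℂ] E :=
  ContinuousLinearMap.adjoint (tmulRight E (basisVec α)) ∘L A ∘L tmulRight E (basisVec β)

theorem inner_fourierCoeff (A : HTensor E (Fock n) →L[ℂ] HTensor E (Fock n)) (α β : Words n)
    (h l : E) :
    ⟪l, fourierCoeff A α β h⟫_ℂ = ⟪tmul l (basisVec α), A (tmul h (basisVec β))⟫_ℂ := by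
  simp [fourierCoeff, ContinuousLinearMap.adjoint_inner_right, tmulRight_apply]

/-- The formal series with coefficients `a` is the formal Fourier series of `A`. -/
def IsFourierSeries (a : Words n → Words n → E →L[ℂ] E)
    (A : HTensor E (Fock n) →L[ℂ] HTensor E (Fock n)) : Prop :=
  ∀ α β : Words n, IsIndex α β → a α β = fourierCoeff A α β

/-- The vector-valued polynomials in `E ⊗ F²(H_{n₁}) ⊗ ⋯ ⊗ F²(H_{n_k})`. -/
def polynomials (E : Type*) [NormedAddCommGroup E] [InnerProductSpace ℂ E] (n : Fin k → ℕ) :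
    Submodule ℂ (HTensor E (Fock n)) :=
  Submodule.span ℂ {x | ∃ (h : E) (ω : Words n), x = tmul h (basisVec ω)}

/-- For each `γ`, the series `∑_{ω ∼_rc γ} A_{(c⁺(ω,γ);c⁻(ω,γ))}^* A_{(c⁺(ω,γ);c⁻(ω,γ))}` converges
in the weak operator topology. -/
def ColumnsWOTSummable (a : Words n → Words n → E →L[ℂ] E) : Prop :=
  ∀ γ : Words n, Summable fun ω : {ω : Words n // RightComparable ω γ} =>
    (ContinuousLinearMapWOT.ofCLM
      (ContinuousLinearMap.adjoint
          (a (fun i => cPlus (ω.1 i) (γ i)) (fun i => cMinus (ω.1 i) (γ i))) ∘L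
        a (fun i => cPlus (ω.1 i) (γ i)) (fun i => cMinus (ω.1 i) (γ i))) : E →WOT[ℂ] E)

/-- The polyball algebra: the norm closed algebra generated by the `𝐒_{i,j}` and the identity. -/
def polyballAlgebra (n : Fin k → ℕ) : Subalgebra ℂ (Fock n →L[ℂ] Fock n) :=
  (Algebra.adjoin ℂ {T | ∃ (i : Fin k) (j : Fin (n i)), T = leftCreation i j}).topologicalClosure

/-- `B(E) ⊗_min 𝒜_n`: the norm closed span of the operators `T ⊗ f`, `T ∈ B(E)`, `f ∈ 𝒜_n`. -/
def minTensor (E : Type*) [NormedAddCommGroup E] [InnerProductSpace ℂ E] (n : Fin k → ℕ) :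
    Submodule ℂ (HTensor E (Fock n) →L[ℂ] HTensor E (Fock n)) :=
  (Submodule.span ℂ
    {Y | ∃ (T : E →L[ℂ] E) (f : Fock n →L[ℂ] Fock n),
      f ∈ polyballAlgebra n ∧ Y = tmap T f}).topologicalClosure

/-- The norm closure of `span {f^* g : f, g ∈ B(E) ⊗_min 𝒜_n}`. -/
def starProductSpan (E : Type*) [NormedAddCommGroup E] [InnerProductSpace ℂ E] [CompleteSpace E]
    (n : Fin k → ℕ) : Submodule ℂ (HTensor E (Fock n) →L[ℂ] HTensor E (Fock n)) :=
  (Submodule.span ℂ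
    {Y | ∃ f ∈ minTensor E n, ∃ g ∈ minTensor E n,
      Y = ContinuousLinearMap.adjoint f ∘L g}).topologicalClosure

end Toeplitz

end Polyball

end

noncomputable section

namespace Polyball

/-! ### Hilbert sums -/

section HilbertSum

variable {ι : Type*} {G H : Type*} [NormedAddCommGroup G] [InnerProductSpace ℂ G] [CompleteSpace G]
  [NormedAddCommGroup H] [InnerProductSpace ℂ H] [CompleteSpace H] {V : ι → G →ₗᵢ[ℂ] H}

/-! A bounded operator `A` on `E ⊗ F` is determined by its entries `fourierCoeff A ω γ`, taken over
all pairs of tuples of words and not only over indices. The proof is a study of this matrix. After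
removal of common suffixes, two tuples either show different last letters in some component, or have
the normal form `ω = α * σ`, `γ = β * σ` in which every component of `α` or of `β` is empty; then `α
= c⁺(ω, γ)` and `β = c⁻(ω, γ)`. The Toeplitz relations cancel a common last letter and annihilate
entries with different last letters. So `A` is multi-Toeplitz with coefficients `a` exactly when its
matrix is `toep a 1` (`isMultiToeplitz_and_isFourierSeries_iff`). Since `𝐒_α 𝐒_β^*` sends `e_{βσ}`
to `e_{ασ}` and kills the other basis vectors, the block of degree `m` of `φ(r𝐒)` is the diagonal
`deg ω γ = m` of the matrix `toep a r`, which is `toep a 1` damped by `r ^ ∑ |deg ω γ i|`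
(`fourierCoeff_block`).

Let `A` be multi-Toeplitz. A single diagonal of its matrix has norm at most `‖A‖`
(`norm_block_one_le`), so for `r < 1` the blocks are dominated by a product of geometric series and
`φ(r𝐒)` converges absolutely. The Berezin kernel sends `e_γ` to the sum of `r^{|β|} Δ(σ)^{1/2} e_β ⊗
e_σ` over all factorizations `γ = β * σ`, where `Δ(σ)` is the eigenvalue of the defect operator. A
telescoping sum over suffixes (`sum_suffixes`) shows that it is an isometry and that the Berezin
transform of `A` has the matrix `toep a r` (`fourierCoeff_berezinExt`). Thus `φ(r𝐒)` is that
transform and `‖φ(r𝐒)‖ ≤ ‖A‖`. On `h ⊗ e_γ` dominated convergence gives `φ(r𝐒) → A` as `r → 1`; the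
uniform bound extends this to all vectors, and the norm formulas follow.

Conversely, a uniform bound of `φ(r𝐒)` on polynomials bounds all finite sections of `toep a r`. A
finite section depends continuously on `r`, so the bound survives at `r = 1`, where it makes `toep a
1` the matrix of a bounded operator (`exists_of_polynomial_bound`). Condition (i) says that the
columns of `toep a 1` applied to vectors are square summable. -/

theorem IsHilbertSum.equiv_apply (hV : IsHilbertSum ℂ (fun _ : ι => G) V) (x : H) (i : ι) :
    hV.linearIsometryEquiv x i =
      ContinuousLinearMap.adjoint (V i).toContinuousLinearMap x := by
  classical
  refine ext_inner_left ℂ fun y => ?_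
  rw [ContinuousLinearMap.adjoint_inner_right, LinearIsometry.coe_toContinuousLinearMap,
    ← hV.linearIsometryEquiv_symm_apply_single, LinearIsometryEquiv.inner_map_eq_flip,
    LinearIsometryEquiv.symm_symm, lp.inner_single_left]

theorem IsHilbertSum.hasSum_coord (hV : IsHilbertSum ℂ (fun _ : ι => G) V) (x : H) :
    HasSum (fun i => V i (ContinuousLinearMap.adjoint (V i).toContinuousLinearMap x)) x := by
  have h := hV.hasSum_linearIsometryEquiv_symm (hV.linearIsometryEquiv x)
  simpa only [IsHilbertSum.equiv_apply, LinearIsometryEquiv.symm_apply_apply] using h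

theorem IsHilbertSum.hasSum_norm_sq (hV : IsHilbertSum ℂ (fun _ : ι => G) V) (x : H) :
    HasSum (fun i => ‖ContinuousLinearMap.adjoint (V i).toContinuousLinearMap x‖ ^ 2)
      (‖x‖ ^ 2) := by
  have h := lp.hasSum_norm (p := 2) (by norm_num) (hV.linearIsometryEquiv x)
  simpa [IsHilbertSum.equiv_apply] using h

theorem IsHilbertSum.exists_of_summable (hV : IsHilbertSum ℂ (fun _ : ι => G) V) {c : ι → G}
    (hc : Summable fun i => ‖c i‖ ^ 2) :
    ∃ x : H, ∀ i, ContinuousLinearMap.adjoint (V i).toContinuousLinearMap x = c i := by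
  have hm : Memℓp c 2 := memℓp_gen (by simpa using hc)
  refine ⟨hV.linearIsometryEquiv.symm ⟨c, hm⟩, fun i => ?_⟩
  rw [← IsHilbertSum.equiv_apply hV, LinearIsometryEquiv.apply_symm_apply]

theorem IsHilbertSum.ext_coord (hV : IsHilbertSum ℂ (fun _ : ι => G) V) {x y : H}
    (h : ∀ i, ContinuousLinearMap.adjoint (V i).toContinuousLinearMap x
      = ContinuousLinearMap.adjoint (V i).toContinuousLinearMap y) : x = y := by
  refine (IsHilbertSum.hasSum_coord hV x).unique ?_
  simpa only [h] using IsHilbertSum.hasSum_coord hV y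

end HilbertSum

/-! ### Operators on Hilbert space tensor products -/

section Tensor

variable {E F G H E' F' : Type*}
  [NormedAddCommGroup E] [InnerProductSpace ℂ E] [NormedAddCommGroup F] [InnerProductSpace ℂ F]
  [NormedAddCommGroup G] [InnerProductSpace ℂ G] [NormedAddCommGroup H] [InnerProductSpace ℂ H]
  [NormedAddCommGroup E'] [InnerProductSpace ℂ E'] [NormedAddCommGroup F'] [InnerProductSpace ℂ F']

/-- The bounded operator `y ↦ x ⊗ y`. -/
def tmulLeft (F : Type*) [NormedAddCommGroup F] [InnerProductSpace ℂ F] (x : E) :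
    F →L[ℂ] HTensor E F :=
  (incl E F).toContinuousLinearMap ∘L TensorProduct.mkL ℂ E F x

theorem tmulLeft_apply (x : E) (y : F) : tmulLeft F x y = tmul x y := rfl

theorem tmul_smul_right (c : ℂ) (x : E) (y : F) : tmul x (c • y) = c • tmul x y := by
  simp only [← tmulLeft_apply, map_smul]

theorem tmul_zero_left (y : F) : tmul (0 : E) y = 0 := by
  simp only [← tmulRight_apply, map_zero]

theorem tmul_sum_right {ι : Type*} (s : Finset ι) (x : E) (y : ι → F) :
    tmul x (∑ i ∈ s, y i) = ∑ i ∈ s, tmul x (y i) := by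
  simp only [← tmulLeft_apply, map_sum]

theorem mem_of_tmul_mem {S : Submodule ℂ (HTensor E F)} (hS : IsClosed (S : Set (HTensor E F)))
    (h : ∀ x y, tmul x y ∈ S) (z : HTensor E F) : z ∈ S := by
  refine denseRange_incl.induction_on (p := fun z => z ∈ S) z hS fun a => ?_
  induction a using TensorProduct.induction_on with
  | zero => simp
  | add a b ha hb => simpa using S.add_mem ha hb
  | tmul x y => exact h x y

theorem clm_ext_tmul {f g : HTensor E F →L[ℂ] G}
    (h : ∀ x y, f (tmul x y) = g (tmul x y)) : f = g := by
  have hd : Function.Injective fun z : HTensor E F →L[ℂ] G => (z : HTensor E F → G) :=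
    DFunLike.coe_injective
  refine hd (denseRange_incl.equalizer f.continuous g.continuous (funext fun z => ?_))
  induction z using TensorProduct.induction_on with
  | zero => simp
  | add a b ha hb => simpa using congrArg₂ (· + ·) ha hb
  | tmul x y => exact h x y

/-- Extension along an isometry with dense range does not increase the norm, so the estimate on the
algebraic tensor product carries over. -/
theorem norm_tmap_le (f : E →L[ℂ] G) (g : F →L[ℂ] H) : ‖tmap f g‖ ≤ ‖f‖ * ‖g‖ := by
  have h := ContinuousLinearMap.opNorm_extend_le (N := 1)
    (((incl G H).toContinuousLinearMap ∘L TensorProduct.mapL f g))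
    (e := (incl E F).toContinuousLinearMap) denseRange_incl (fun x => by simp)
  refine h.trans ?_
  rw [NNReal.coe_one, one_mul]
  refine (ContinuousLinearMap.opNorm_comp_le _ _).trans ?_
  calc _ ≤ 1 * ‖TensorProduct.mapL f g‖ := by
        gcongr; exact LinearIsometry.norm_toContinuousLinearMap_le _
    _ ≤ _ := by rw [one_mul]; exact TensorProduct.norm_mapL_le f g

theorem tmap_comp (f : E →L[ℂ] G) (g : F →L[ℂ] H) (f' : G →L[ℂ] E') (g' : H →L[ℂ] F') :
    tmap f' g' ∘L tmap f g = tmap (f' ∘L f) (g' ∘L g) :=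
  clm_ext_tmul fun x y => by simp [tmap_tmul]

theorem tmap_smul_right (c : ℂ) (f : E →L[ℂ] G) (g : F →L[ℂ] H) :
    tmap f (c • g) = c • tmap f g :=
  clm_ext_tmul fun x y => by simp [tmap_tmul, tmul_smul_right]

theorem tassoc_symm_tmul (x : E) (y : F) (z : G) :
    (tassoc E F G).symm (tmul x (tmul y z)) = tmul (tmul x y) z := by
  rw [LinearIsometryEquiv.symm_apply_eq, tassoc_tmul]

variable [CompleteSpace E] [CompleteSpace F] [CompleteSpace G] [CompleteSpace H]

theorem adjoint_tmap (f : E →L[ℂ] G) (g : F →L[ℂ] H) :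
    ContinuousLinearMap.adjoint (tmap f g)
      = tmap (ContinuousLinearMap.adjoint f) (ContinuousLinearMap.adjoint g) := by
  refine clm_ext_tmul fun x y => ?_
  refine ext_inner_right ℂ fun z => ?_
  rw [ContinuousLinearMap.adjoint_inner_left]
  have : (innerSL ℂ (tmul x y)) ∘L tmap f g = innerSL ℂ
      (tmap (ContinuousLinearMap.adjoint f) (ContinuousLinearMap.adjoint g) (tmul x y)) :=
    clm_ext_tmul fun u v => by
      simp [tmap_tmul, inner_tmul, ContinuousLinearMap.adjoint_inner_left]
  exact DFunLike.congr_fun this z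

end Tensor

/-! ### Coordinates with respect to the Fock basis, and matrices of operators -/

section Coord

variable {k : ℕ} {n : Fin k → ℕ}

theorem hasSum_basisVec (y : Fock n) : HasSum (fun γ => y γ • (basisVec γ : Fock n)) y := by
  classical
  have h := lp.hasSum_single (p := 2) (by norm_num) y
  refine h.congr_fun fun γ => ?_
  ext ω
  by_cases hω : ω = γ <;> simp [basisVec, hω, lp.single_apply]

theorem inner_basisVec (γ : Words n) (y : Fock n) : ⟪basisVec γ, y⟫_ℂ = y γ := by
  classical
  simp only [basisVec]
  rw [lp.inner_single_left]
  simp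

theorem basisVec_apply_self (γ : Words n) : (basisVec γ : Fock n) γ = 1 := by
  classical
  simp [basisVec]

theorem basisVec_apply_ne {γ ω : Words n} (h : ω ≠ γ) : (basisVec γ : Fock n) ω = 0 := by
  classical
  simp [basisVec, lp.single_apply, h]

theorem clm_ext_basisVec {G : Type*} [NormedAddCommGroup G] [InnerProductSpace ℂ G]
    {f g : Fock n →L[ℂ] G} (h : ∀ γ, f (basisVec γ) = g (basisVec γ)) : f = g := by
  ext1 y
  have h1 := f.hasSum (hasSum_basisVec y)
  have h2 := g.hasSum (hasSum_basisVec y)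
  simp only [map_smul, h] at h1 h2
  exact h1.unique h2

variable {E : Type*} [NormedAddCommGroup E] [InnerProductSpace ℂ E]

/-- The isometry `h ↦ h ⊗ e_γ`. -/
def rightIso (E : Type*) [NormedAddCommGroup E] [InnerProductSpace ℂ E] (γ : Words n) :
    E →ₗᵢ[ℂ] HTensor E (Fock n) where
  toLinearMap := (tmulRight E (basisVec γ)).toLinearMap
  norm_map' x := by
    simp [tmulRight_apply, norm_tmul, orthonormal_basisVec.1 γ]

/-- The isometry `h ↦ e_γ ⊗ h`. -/
def leftIso (E : Type*) [NormedAddCommGroup E] [InnerProductSpace ℂ E] (γ : Words n) :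
    E →ₗᵢ[ℂ] HTensor (Fock n) E where
  toLinearMap := (tmulLeft E (basisVec γ)).toLinearMap
  norm_map' x := by
    simp [tmulLeft_apply, norm_tmul, orthonormal_basisVec.1 γ]

theorem mem_polynomials_tmul (h : E) (γ : Words n) : tmul h (basisVec γ) ∈ polynomials E n :=
  Submodule.subset_span ⟨h, γ, rfl⟩

variable [CompleteSpace E]

theorem isHilbertSum_rightIso :
    IsHilbertSum ℂ (fun _ : Words n => E) (fun γ => rightIso E γ) := by
  refine IsHilbertSum.mk ?_ ?_
  · intro γ ω h x y
    simp only [rightIso, LinearIsometry.coe_mk, ContinuousLinearMap.coe_coe, tmulRight_apply,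
      inner_tmul]
    rw [orthonormal_basisVec.2 h, mul_zero]
  · intro z _
    refine mem_of_tmul_mem (Submodule.isClosed_topologicalClosure _) (fun x y => ?_) z
    have h := (tmulLeft (Fock n) x).hasSum (hasSum_basisVec y)
    refine (Submodule.isClosed_topologicalClosure _).mem_of_tendsto h
      (Filter.Eventually.of_forall fun s => Submodule.sum_mem _ fun γ _ => ?_)
    rw [map_smul]
    refine Submodule.smul_mem _ _ (Submodule.le_topologicalClosure _ ?_)
    exact Submodule.mem_iSup_of_mem γ ⟨x, rfl⟩

theorem isHilbertSum_leftIso :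
    IsHilbertSum ℂ (fun _ : Words n => E) (fun γ => leftIso E γ) := by
  refine IsHilbertSum.mk ?_ ?_
  · intro γ ω h x y
    simp only [leftIso, LinearIsometry.coe_mk, ContinuousLinearMap.coe_coe, tmulLeft_apply,
      inner_tmul]
    rw [orthonormal_basisVec.2 h, zero_mul]
  · intro z _
    refine mem_of_tmul_mem (Submodule.isClosed_topologicalClosure _) (fun x y => ?_) z
    have h := (tmulRight (Fock n) y).hasSum (hasSum_basisVec x)
    refine (Submodule.isClosed_topologicalClosure _).mem_of_tendsto h
      (Filter.Eventually.of_forall fun s => Submodule.sum_mem _ fun γ _ => ?_)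
    rw [map_smul]
    refine Submodule.smul_mem _ _ (Submodule.le_topologicalClosure _ ?_)
    exact Submodule.mem_iSup_of_mem γ ⟨y, rfl⟩

/-- The coordinate `x_γ` of `x = ∑ x_γ ⊗ e_γ`. -/
def coord (γ : Words n) : HTensor E (Fock n) →L[ℂ] E :=
  ContinuousLinearMap.adjoint (tmulRight E (basisVec γ))

theorem inner_coord (γ : Words n) (l : E) (x : HTensor E (Fock n)) :
    ⟪l, coord γ x⟫_ℂ = ⟪tmul l (basisVec γ), x⟫_ℂ := by
  rw [coord, ContinuousLinearMap.adjoint_inner_right, tmulRight_apply]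

theorem coord_tmul (γ : Words n) (h : E) (y : Fock n) : coord γ (tmul h y) = y γ • h := by
  refine ext_inner_left ℂ fun l => ?_
  rw [inner_coord, inner_tmul, inner_basisVec, inner_smul_right, mul_comm]

theorem coord_tmul_self (γ : Words n) (h : E) : coord γ (tmul h (basisVec γ)) = h := by
  rw [coord_tmul, basisVec_apply_self, one_smul]

theorem coord_tmul_ne {γ ω : Words n} (hne : ω ≠ γ) (h : E) :
    coord ω (tmul h (basisVec γ)) = 0 := by
  rw [coord_tmul, basisVec_apply_ne hne, zero_smul]

theorem hasSum_coord (x : HTensor E (Fock n)) :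
    HasSum (fun γ => tmul (coord γ x) (basisVec γ)) x :=
  IsHilbertSum.hasSum_coord isHilbertSum_rightIso x

theorem hasSum_norm_coord_sq (x : HTensor E (Fock n)) :
    HasSum (fun γ : Words n => ‖coord γ x‖ ^ 2) (‖x‖ ^ 2) :=
  IsHilbertSum.hasSum_norm_sq isHilbertSum_rightIso x

theorem exists_coord_eq {c : Words n → E} (hc : Summable fun γ => ‖c γ‖ ^ 2) :
    ∃ x : HTensor E (Fock n), ∀ γ, coord γ x = c γ :=
  IsHilbertSum.exists_of_summable isHilbertSum_rightIso hc

theorem ext_coord {x y : HTensor E (Fock n)} (h : ∀ γ, coord γ x = coord γ y) : x = y :=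
  IsHilbertSum.ext_coord isHilbertSum_rightIso h

theorem sum_norm_coord_sq_le (x : HTensor E (Fock n)) (s : Finset (Words n)) :
    ∑ γ ∈ s, ‖coord γ x‖ ^ 2 ≤ ‖x‖ ^ 2 :=
  sum_le_hasSum s (fun _ _ => by positivity) (hasSum_norm_coord_sq x)

theorem norm_sq_le_of_sum_le {x : HTensor E (Fock n)} {C : ℝ}
    (h : ∀ s : Finset (Words n), ∑ γ ∈ s, ‖coord γ x‖ ^ 2 ≤ C) : ‖x‖ ^ 2 ≤ C :=
  hasSum_le_of_sum_le (hasSum_norm_coord_sq x) h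

theorem fourierCoeff_apply (A : HTensor E (Fock n) →L[ℂ] HTensor E (Fock n)) (α β : Words n)
    (h : E) : fourierCoeff A α β h = coord α (A (tmul h (basisVec β))) := rfl

/-- The principle by which identities between operators are proved below: compare matrix entries. -/
theorem clm_ext_fourierCoeff {A B : HTensor E (Fock n) →L[ℂ] HTensor E (Fock n)}
    (h : ∀ ω γ, fourierCoeff A ω γ = fourierCoeff B ω γ) : A = B := by
  have key : ∀ x γ, A (tmul x (basisVec γ)) = B (tmul x (basisVec γ)) := fun x γ =>
    ext_coord fun ω => by rw [← fourierCoeff_apply, ← fourierCoeff_apply, h]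
  ext1 x
  have h1 := A.hasSum (hasSum_coord x)
  have h2 := B.hasSum (hasSum_coord x)
  simp only [key] at h1 h2
  exact h1.unique h2

/-- The coordinate of `x = ∑ e_γ ⊗ x_γ`. -/
def leftCoord (γ : Words n) : HTensor (Fock n) E →L[ℂ] E :=
  ContinuousLinearMap.adjoint (tmulLeft E (basisVec γ))

theorem leftCoord_tmul (γ : Words n) (y : Fock n) (h : E) :
    leftCoord γ (tmul y h) = y γ • h := by
  refine ext_inner_left ℂ fun l => ?_
  rw [leftCoord, ContinuousLinearMap.adjoint_inner_right, tmulLeft_apply, inner_tmul,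
    inner_basisVec, inner_smul_right]

theorem hasSum_leftCoord (x : HTensor (Fock n) E) :
    HasSum (fun γ => tmul (basisVec γ) (leftCoord γ x)) x :=
  IsHilbertSum.hasSum_coord isHilbertSum_leftIso x

theorem dense_polynomials : Dense (polynomials E n : Set (HTensor E (Fock n))) := by
  intro x
  exact mem_closure_of_tendsto (hasSum_coord x) (Filter.Eventually.of_forall fun s =>
    Submodule.sum_mem _ fun γ _ => mem_polynomials_tmul _ γ)

theorem fourierCoeff_tmap (f : E →L[ℂ] E) (g : Fock n →L[ℂ] Fock n) (ω γ : Words n) :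
    fourierCoeff (tmap f g) ω γ = (g (basisVec γ) ω) • f := by
  ext1 h
  rw [fourierCoeff_apply, tmap_tmul, coord_tmul]
  rfl

theorem coord_sum_tmul_of_mem {s : Finset (Words n)} (x : Words n → E) {ω : Words n}
    (hω : ω ∈ s) : coord ω (∑ γ ∈ s, tmul (x γ) (basisVec γ)) = x ω := by
  rw [map_sum, Finset.sum_eq_single_of_mem ω hω, coord_tmul_self]
  intro γ _ hne
  exact coord_tmul_ne hne.symm _

theorem coord_sum_tmul_of_notMem {s : Finset (Words n)} (x : Words n → E) {ω : Words n}
    (hω : ω ∉ s) : coord ω (∑ γ ∈ s, tmul (x γ) (basisVec γ)) = 0 := by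
  rw [map_sum]
  refine Finset.sum_eq_zero fun γ hγ => coord_tmul_ne (by rintro rfl; exact hω hγ) _

theorem norm_sq_sum_tmul (s : Finset (Words n)) (x : Words n → E) :
    ‖∑ γ ∈ s, tmul (x γ) (basisVec γ)‖ ^ 2 = ∑ γ ∈ s, ‖x γ‖ ^ 2 := by
  refine (hasSum_norm_coord_sq _).unique ?_
  convert hasSum_sum_of_ne_finset_zero (s := s) (L := SummationFilter.unconditional _) ?_ using 1
  · exact Finset.sum_congr rfl fun γ hγ => by rw [coord_sum_tmul_of_mem x hγ]
  · intro γ hγ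
    rw [coord_sum_tmul_of_notMem x hγ]; simp

/-- A matrix that is bounded on finitely supported vectors defines a bounded operator. -/
theorem exists_clm_of_matrix (M : Words n → Words n → E →L[ℂ] E) {C : ℝ} (hC : 0 ≤ C)
    (hM : ∀ (s t : Finset (Words n)) (x : Words n → E),
      ∑ ω ∈ t, ‖∑ γ ∈ s, M ω γ (x γ)‖ ^ 2 ≤ C ^ 2 * ∑ γ ∈ s, ‖x γ‖ ^ 2) :
    ∃ A : HTensor E (Fock n) →L[ℂ] HTensor E (Fock n), ∀ ω γ, fourierCoeff A ω γ = M ω γ := by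
  classical
  -- The bound for the single column `s = {γ}` makes that column square summable.
  have hcol : ∀ γ h, ∃ y : HTensor E (Fock n), ∀ ω, coord ω y = M ω γ h := fun γ h => by
    refine exists_coord_eq (summable_of_sum_le (c := C ^ 2 * ‖h‖ ^ 2) (fun _ => by positivity)
      fun t => ?_)
    simpa using hM {γ} t fun _ => h
  choose col hcol using hcol
  let colL : Words n → E →ₗ[ℂ] HTensor E (Fock n) := fun γ =>
    { toFun := col γ
      map_add' := fun x y => ext_coord fun ω => by simp [hcol]
      map_smul' := fun c x => ext_coord fun ω => by simp [hcol] }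
  -- `e` realizes finitely supported families as polynomials, and `f` applies the matrix to them.
  -- The operator is the continuous extension of `f` along the dense range of `e`; `hb` is the bound
  -- that this needs.
  let f : (Words n →₀ E) →ₗ[ℂ] HTensor E (Fock n) := Finsupp.lsum ℂ colL
  let e : (Words n →₀ E) →ₗ[ℂ] HTensor E (Fock n) :=
    Finsupp.lsum ℂ fun γ => (tmulRight E (basisVec γ)).toLinearMap
  have he : ∀ x, e x = ∑ γ ∈ x.support, tmul (x γ) (basisVec γ) := fun x => rfl
  have hf : ∀ x ω, coord ω (f x) = ∑ γ ∈ x.support, M ω γ (x γ) := fun x ω => by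
    have : f x = ∑ γ ∈ x.support, col γ (x γ) := rfl
    simp [this, hcol]
  have hdense : DenseRange e := by
    refine dense_polynomials.mono ?_
    have : polynomials E n ≤ LinearMap.range e := by
      refine Submodule.span_le.2 ?_
      rintro _ ⟨h, ω, rfl⟩
      exact ⟨Finsupp.single ω h, Finsupp.lsum_single ℂ _ _ _⟩
    exact this
  have hb : ∀ x, ‖f x‖ ≤ C * ‖e x‖ := fun x => by
    refine le_of_sq_le_sq ?_ (by positivity)
    rw [mul_pow, he, norm_sq_sum_tmul]
    refine norm_sq_le_of_sum_le fun t => ?_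
    simpa only [hf] using hM x.support t x
  refine ⟨f.extendOfNorm e, fun ω γ => ?_⟩
  ext1 h
  have h1 : e (Finsupp.single γ h) = tmul h (basisVec γ) := Finsupp.lsum_single ℂ _ _ _
  have h2 : f (Finsupp.single γ h) = col γ h := Finsupp.lsum_single ℂ _ _ _
  rw [fourierCoeff_apply, ← h1, LinearMap.extendOfNorm_eq hdense ⟨C, hb⟩, h2, hcol]

/-- Regrouping of the coordinates of a vector. -/
theorem hasSum_of_coord_fiber {ι : Type*} (d : Words n → ι) (x : HTensor E (Fock n))
    (y : ι → HTensor E (Fock n)) (hy : ∀ ω, coord ω (y (d ω)) = coord ω x)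
    (hy' : ∀ m ω, d ω ≠ m → coord ω (y m) = 0) : HasSum y x := by
  have h := (Equiv.sigmaFiberEquiv d).hasSum_iff.2 (hasSum_coord x)
  refine h.sigma fun m => ?_
  have h2 := hasSum_coord (y m)
  rw [← hasSum_subtype_iff_of_support_subset (s := {ω | d ω = m})] at h2
  · refine h2.congr_fun ?_
    rintro ⟨ω, rfl⟩
    simp [Equiv.sigmaFiberEquiv, hy]
  · intro ω hω
    by_contra hne
    exact hω (by simp only; rw [hy' m ω hne, tmul_zero_left])

end Coord

/-! ### Two-sided and iterated series -/

section IterSum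

variable {V W : Type*}

theorem HasTwoSidedSum.unique [AddCommGroup V] [TopologicalSpace V] [T2Space V] {f : ℤ → V}
    {s t : V} (hs : HasTwoSidedSum f s) (ht : HasTwoSidedSum f t) : s = t := by
  obtain ⟨a, b, ha, hb, rfl⟩ := hs
  obtain ⟨c, d, hc, hd, rfl⟩ := ht
  rw [tendsto_nhds_unique ha hc, tendsto_nhds_unique hb hd]

theorem HasIterSum.unique [AddCommGroup V] [TopologicalSpace V] [T2Space V] :
    ∀ {k : ℕ} {f : (Fin k → ℤ) → V} {s t : V}, HasIterSum f s → HasIterSum f t → s = t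
  | 0, _, _, _, hs, ht => Eq.trans (Eq.symm hs) ht
  | k + 1, f, s, t, hs, ht => by
    obtain ⟨g, hg, hs⟩ := hs
    obtain ⟨g', hg', ht⟩ := ht
    have : g = g' := funext fun m => (hg m).unique (hg' m)
    exact hs.unique (this ▸ ht)

theorem HasTwoSidedSum.map [AddCommGroup V] [TopologicalSpace V] [AddCommGroup W]
    [TopologicalSpace W] (φ : V →+ W) (hφ : Continuous φ) {f : ℤ → V} {s : V}
    (hs : HasTwoSidedSum f s) : HasTwoSidedSum (fun m => φ (f m)) (φ s) := by
  obtain ⟨a, b, ha, hb, rfl⟩ := hs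
  refine ⟨φ a, φ b, ?_, ?_, map_add _ _ _⟩
  · simpa [Function.comp_def] using (hφ.tendsto a).comp ha
  · simpa [Function.comp_def] using (hφ.tendsto b).comp hb

theorem HasIterSum.map [AddCommGroup V] [TopologicalSpace V] [AddCommGroup W]
    [TopologicalSpace W] (φ : V →+ W) (hφ : Continuous φ) :
    ∀ {k : ℕ} {f : (Fin k → ℤ) → V} {s : V}, HasIterSum f s →
      HasIterSum (fun m => φ (f m)) (φ s)
  | 0, _, _, hs => congrArg φ hs
  | k + 1, f, s, hs => by
    obtain ⟨g, hg, hs⟩ := hs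
    exact ⟨fun m => φ (g m), fun m => (hg m).map φ hφ, hs.map φ hφ⟩

theorem HasTwoSidedSum.of_hasSum [AddCommGroup V] [UniformSpace V] [IsUniformAddGroup V]
    [CompleteSpace V] [T2Space V] {f : ℤ → V} {s : V} (hs : HasSum f s) : HasTwoSidedSum f s := by
  have h1 : Summable fun p : ℕ => f (-((p : ℤ) + 1)) :=
    hs.summable.comp_injective (i := fun p : ℕ => -((p : ℤ) + 1)) fun p q h => by
      simpa using h
  have h2 : Summable fun p : ℕ => f (p : ℤ) := hs.summable.comp_injective Nat.cast_injective
  refine ⟨_, _, h1.hasSum.tendsto_sum_nat, h2.hasSum.tendsto_sum_nat, ?_⟩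
  rw [add_comm]
  exact hs.unique (h2.hasSum.of_nat_of_neg_add_one h1.hasSum)

/-- Fubini for unconditional sums: completeness makes every slice summable, so one variable after
another can be summed. All iterated sums of the theorem are obtained in this way. -/
theorem HasIterSum.of_hasSum [NormedAddCommGroup V] [CompleteSpace V] :
    ∀ {k : ℕ} {f : (Fin k → ℤ) → V} {s : V}, HasSum f s → HasIterSum f s
  | 0, f, s, hs => by
    have := hasSum_fintype f
    simpa [HasIterSum, Subsingleton.elim _ (Fin.elim0 : Fin 0 → ℤ)] using this.unique hs
  | k + 1, f, s, hs => by
    have h := (Fin.consEquiv fun _ : Fin (k + 1) => ℤ).hasSum_iff.2 hs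
    have hf : ∀ m, Summable fun m' : Fin k → ℤ => f (Fin.cons m m') := fun m =>
      h.summable.prod_factor m
    refine ⟨fun m => ∑' m', f (Fin.cons m m'), fun m => .of_hasSum (hf m).hasSum,
      .of_hasSum (h.prod_fiberwise fun m => (hf m).hasSum)⟩

end IterSum

theorem summable_pow_natAbs {r : ℝ} (h0 : 0 ≤ r) (h1 : r < 1) :
    Summable fun m : ℤ => r ^ m.natAbs := by
  have h := summable_geometric_of_lt_one h0 h1
  exact Summable.of_nat_of_neg (by simpa using h) (by simpa using h)

/-- The sum over `ℤ^k` is a product of `k` two-sided geometric series. -/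
theorem summable_pow_sum_natAbs {r : ℝ} (h0 : 0 ≤ r) (h1 : r < 1) :
    ∀ k : ℕ, Summable fun m : Fin k → ℤ => r ^ (∑ i, (m i).natAbs)
  | 0 => Summable.of_finite
  | k + 1 => by
    rw [← (Fin.consEquiv fun _ : Fin (k + 1) => ℤ).summable_iff]
    have h := (summable_pow_natAbs h0 h1).mul_of_nonneg (summable_pow_sum_natAbs h0 h1 k)
      (fun _ => by positivity) (fun _ => by positivity)
    refine h.congr fun p => ?_
    simp [Fin.sum_univ_succ, pow_add, Fin.consEquiv]

/-! ### Comparable words -/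

section WordCombinatorics

variable {ι : Type*}

theorem not_rightLT_symm {u v : FreeMonoid ι} (h : RightLT u v) : ¬ RightLT v u := by
  rintro ⟨τ, _, hτ'⟩
  obtain ⟨σ, hσ, rfl⟩ := h
  have := congrArg FreeMonoid.length hτ'
  simp only [FreeMonoid.length_mul] at this
  exact hσ (FreeMonoid.length_eq_zero.1 (by omega))

theorem rightLT_mul {σ u : FreeMonoid ι} (hσ : σ ≠ 1) : RightLT u (σ * u) := ⟨σ, hσ, rfl⟩

theorem not_rightLT_self (u : FreeMonoid ι) : ¬ RightLT u u := fun h => not_rightLT_symm h h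

theorem cPlus_mul (σ u : FreeMonoid ι) : cPlus (σ * u) u = σ := by
  by_cases hσ : σ = 1
  · subst hσ
    rw [one_mul, cPlus, dif_neg (not_rightLT_self u)]
  · have h : RightLT u (σ * u) := rightLT_mul hσ
    rw [cPlus, dif_pos h]
    exact (mul_right_cancel h.choose_spec.2).symm

theorem cPlus_mul_right (σ u : FreeMonoid ι) : cPlus u (σ * u) = 1 := by
  by_cases hσ : σ = 1
  · subst hσ
    rw [one_mul, cPlus, dif_neg (not_rightLT_self u)]
  · rw [cPlus, dif_neg (not_rightLT_symm (rightLT_mul hσ))]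

/-- Remove the longest common suffix: either one of the words is exhausted, and they are comparable,
or the next letters to the left differ. -/
theorem comparable_or_exists (u v : FreeMonoid ι) :
    (RightLT u v ∨ RightLT v u ∨ u = v) ∨
      ∃ (u' v' σ : FreeMonoid ι) (s t : ι), s ≠ t ∧ u = u' * FreeMonoid.of s * σ ∧
        v = v' * FreeMonoid.of t * σ := by
  have key : ∀ u : List ι, ∀ v : FreeMonoid ι, (RightLT (FreeMonoid.ofList u) v ∨
      RightLT v (FreeMonoid.ofList u) ∨ FreeMonoid.ofList u = v) ∨
      ∃ (u' v' σ : FreeMonoid ι) (s t : ι), s ≠ t ∧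
        FreeMonoid.ofList u = u' * FreeMonoid.of s * σ ∧ v = v' * FreeMonoid.of t * σ := by
    intro u
    -- Letters are split off at the right end, since comparability concerns suffixes.
    induction u using List.reverseRecOn with
    | nil =>
      intro v
      left
      by_cases hv : v = 1
      · exact Or.inr (Or.inr hv.symm)
      · exact Or.inl ⟨v, hv, (mul_one v).symm⟩
    | append_singleton u a ih =>
      intro v
      have hu : FreeMonoid.ofList (u ++ [a]) = FreeMonoid.ofList u * FreeMonoid.of a := rfl
      rw [hu]
      induction v using List.reverseRecOn with
      | nil =>
        refine Or.inl (Or.inr (Or.inl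
          ⟨FreeMonoid.ofList u * FreeMonoid.of a, ?_, (mul_one _).symm⟩))
        intro h
        have := congrArg FreeMonoid.length h
        simp at this
      | append_singleton v b _ =>
        have hv : (v ++ [b] : List ι) = FreeMonoid.ofList v * FreeMonoid.of b := rfl
        by_cases hab : a = b
        · subst hab
          rcases ih (FreeMonoid.ofList v) with
            (⟨σ, hσ, h⟩ | ⟨σ, hσ, h⟩ | h) | ⟨u', v', σ, s, t, hst, h1, h2⟩
          · exact Or.inl (Or.inl ⟨σ, hσ, by rw [hv, h, mul_assoc]⟩)
          · exact Or.inl (Or.inr (Or.inl ⟨σ, hσ, by rw [hv, h, mul_assoc]⟩))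
          · exact Or.inl (Or.inr (Or.inr (by rw [hv, h])))
          · exact Or.inr ⟨u', v', σ * FreeMonoid.of a, s, t, hst, by rw [h1, mul_assoc _ σ],
              by rw [hv, h2, mul_assoc _ σ]⟩
        · exact Or.inr ⟨FreeMonoid.ofList u, FreeMonoid.ofList v, 1, a, b, hab, by rw [mul_one],
            by rw [hv, mul_one]⟩
  exact key u v

theorem not_comparable {u v σ : FreeMonoid ι} {s t : ι} (hst : s ≠ t) :
    ¬ (RightLT (u * FreeMonoid.of s * σ) (v * FreeMonoid.of t * σ) ∨
      RightLT (v * FreeMonoid.of t * σ) (u * FreeMonoid.of s * σ) ∨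
      u * FreeMonoid.of s * σ = v * FreeMonoid.of t * σ) := by
  have key : ∀ x y : FreeMonoid ι, ∀ s t : ι, s ≠ t →
      x * FreeMonoid.of s ≠ y * FreeMonoid.of t := by
    intro x y s t hst h
    have h' := congrArg FreeMonoid.toList h
    simp only [FreeMonoid.toList_mul, FreeMonoid.toList_of] at h'
    exact hst (by simpa using (List.append_inj_right' h' rfl))
  rintro (⟨τ, -, h⟩ | ⟨τ, -, h⟩ | h)
  · rw [← mul_assoc, ← mul_assoc] at h
    exact key _ _ _ _ hst.symm (mul_right_cancel h)
  · rw [← mul_assoc, ← mul_assoc] at h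
    exact key _ _ _ _ hst (mul_right_cancel h)
  · exact key _ _ _ _ hst (mul_right_cancel h)

end WordCombinatorics

/-! ### Tuples of words: normal form of a comparable pair, and multidegree -/

section Words

variable {k : ℕ} {n : Fin k → ℕ}

/-- The tuple `c⁺(ω, γ)`. -/
def cP (ω γ : Words n) : Words n := fun i => cPlus (ω i) (γ i)

/-- The tuple `c⁻(ω, γ)`. -/
def cM (ω γ : Words n) : Words n := fun i => cMinus (ω i) (γ i)

/-- The total length of a tuple of words. -/
def len (α : Words n) : ℕ := ∑ i, (α i).length

theorem len_mul (α β : Words n) : len (α * β) = len α + len β := by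
  simp [len, Finset.sum_add_distrib]

/-- In every component, `α` or `β` is the empty word. -/
def Disj (α β : Words n) : Prop := ∀ i, α i = 1 ∨ β i = 1

/-- In each component the shorter of the two words serves as the common suffix `σ`. -/
theorem RightComparable.exists_eq_mul {ω γ : Words n} (h : RightComparable ω γ) :
    Disj (cP ω γ) (cM ω γ) ∧ ∃ σ : Words n, ω = cP ω γ * σ ∧ γ = cM ω γ * σ := by
  have key : ∀ i, (cPlus (ω i) (γ i) = 1 ∨ cMinus (ω i) (γ i) = 1) ∧
      ∃ σ, ω i = cPlus (ω i) (γ i) * σ ∧ γ i = cMinus (ω i) (γ i) * σ := by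
    intro i
    rcases h i with ⟨τ, hτ, h⟩ | ⟨τ, hτ, h⟩ | h
    · simp only [cMinus, h, cPlus_mul, cPlus_mul_right]
      exact ⟨by simp, ω i, (one_mul _).symm, rfl⟩
    · simp only [cMinus, h, cPlus_mul, cPlus_mul_right]
      exact ⟨by simp, γ i, rfl, (one_mul _).symm⟩
    · have := cPlus_mul 1 (γ i)
      rw [one_mul] at this
      simp only [cMinus, h, this]
      exact ⟨by simp, γ i, (one_mul _).symm, (one_mul _).symm⟩
  choose h1 σ h2 h3 using key
  exact ⟨h1, σ, funext h2, funext h3⟩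

/-- Converse of `RightComparable.exists_eq_mul`, and uniqueness of the normal form: `α` and `β` are
recovered from `α * σ` and `β * σ`. -/
theorem Disj.comparable {α β : Words n} (h : Disj α β) (σ : Words n) :
    RightComparable (α * σ) (β * σ) ∧ cP (α * σ) (β * σ) = α ∧ cM (α * σ) (β * σ) = β := by
  refine ⟨fun i => ?_, funext fun i => ?_, funext fun i => ?_⟩
  · rcases h i with h | h
    · simp only [Pi.mul_apply, h, one_mul]
      by_cases hb : β i = 1
      · exact Or.inr (Or.inr (by rw [hb, one_mul]))
      · exact Or.inl (rightLT_mul hb)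
    · simp only [Pi.mul_apply, h, one_mul]
      by_cases hb : α i = 1
      · exact Or.inr (Or.inr (by rw [hb, one_mul]))
      · exact Or.inr (Or.inl (rightLT_mul hb))
  · rcases h i with h | h <;> simp only [cP, Pi.mul_apply, h, one_mul, cPlus_mul, cPlus_mul_right]
  · rcases h i with h | h <;>
      simp only [cM, cMinus, Pi.mul_apply, h, one_mul, cPlus_mul, cPlus_mul_right]

/-- At most one of `m_i^-` and `m_i^+` is nonzero; conversely `m_i = |β_i| - |α_i|` works. -/
theorem isIndex_iff {α β : Words n} : IsIndex α β ↔ Disj α β := by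
  constructor
  · rintro ⟨m, hm⟩ i
    obtain ⟨h1, h2⟩ := hm i
    rcases le_total (m i) 0 with h | h
    · right
      exact FreeMonoid.length_eq_zero.1 (by omega)
    · left
      exact FreeMonoid.length_eq_zero.1 (by omega)
  · intro h
    refine ⟨fun i => (β i).length - (α i).length, fun i => ?_⟩
    rcases h i with h | h <;> simp [h]

/-- The multidegree `(|γ_i| - |ω_i|)_i`. -/
def deg (ω γ : Words n) : Fin k → ℤ := fun i => (γ i).length - (ω i).length

theorem deg_mul_mul (α β σ : Words n) : deg (α * σ) (β * σ) = deg α β := by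
  funext i
  simp [deg]

theorem hasDegree_iff {m : Fin k → ℤ} {α β : Words n} :
    HasDegree m α β ↔ Disj α β ∧ deg α β = m := by
  constructor
  · intro h
    refine ⟨isIndex_iff.1 ⟨m, h⟩, funext fun i => ?_⟩
    have := h i
    simp only [deg]
    omega
  · rintro ⟨h, rfl⟩ i
    rcases h i with h | h <;> simp [h, deg]

/-- For an index the exponent of `r` depends on the multidegree alone, so `r` enters each block as a
single scalar factor. -/
theorem Disj.len_add_len {α β : Words n} (h : Disj α β) :
    len α + len β = ∑ i, (deg α β i).natAbs := by
  simp only [len, deg, ← Finset.sum_add_distrib]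
  refine Finset.sum_congr rfl fun i _ => ?_
  rcases h i with h | h <;> simp [h]

theorem RightComparable.deg_eq {ω γ : Words n} (h : RightComparable ω γ) :
    deg (cP ω γ) (cM ω γ) = deg ω γ := by
  obtain ⟨-, σ, h1, h2⟩ := h.exists_eq_mul
  rw [← deg_mul_mul _ _ σ, ← h1, ← h2]

theorem rightComparable_mul_iff {ω γ σ : Words n} :
    RightComparable (ω * σ) (γ * σ) ↔ RightComparable ω γ := by
  constructor
  · intro h i
    rcases comparable_or_exists (ω i) (γ i) with h' | ⟨u, v, τ, s, t, hst, hu, hv⟩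
    · exact h'
    · exfalso
      have := h i
      simp only [Pi.mul_apply, hu, hv, mul_assoc _ τ] at this
      rcases this with h | h | h
      · exact not_comparable hst (Or.inl h)
      · exact not_comparable hst (Or.inr (Or.inl h))
      · exact not_comparable hst (Or.inr (Or.inr h))
  · intro h
    obtain ⟨hd, τ, h1, h2⟩ := h.exists_eq_mul
    have := (hd.comparable (τ * σ)).1
    rwa [← mul_assoc, ← mul_assoc, ← h1, ← h2] at this

theorem RightComparable.cP_mul {ω γ : Words n} (h : RightComparable ω γ) (σ : Words n) :
    cP (ω * σ) (γ * σ) = cP ω γ ∧ cM (ω * σ) (γ * σ) = cM ω γ := by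
  obtain ⟨hd, τ, h1, h2⟩ := h.exists_eq_mul
  have := (hd.comparable (τ * σ)).2
  rwa [← mul_assoc, ← mul_assoc, ← h1, ← h2] at this

theorem consRight_eq (i : Fin k) (j : Fin (n i)) (γ : Words n) :
    consRight i j γ = γ * Pi.mulSingle i (FreeMonoid.of j) := by
  funext l
  by_cases h : l = i
  · subst h; simp [consRight]
  · simp [consRight, h]

theorem consLeft_eq (i : Fin k) (j : Fin (n i)) (γ : Words n) :
    consLeft i j γ = Pi.mulSingle i (FreeMonoid.of j) * γ := by
  funext l
  by_cases h : l = i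
  · subst h; simp [consLeft]
  · simp [consLeft, h]

theorem not_rightComparable_consRight {i : Fin k} {s t : Fin (n i)} (hst : s ≠ t) (ω γ : Words n) :
    ¬ RightComparable (consRight i s ω) (consRight i t γ) := by
  intro h
  have := h i
  simp only [consRight, Function.update_self] at this
  exact not_comparable (σ := 1) hst (by simpa only [mul_one] using this)

/-- Brings a non-comparable pair to the form to which the Toeplitz relation with `s ≠ t` applies,
after cancellation of `σ`. -/
theorem exists_of_not_rightComparable {ω γ : Words n} (h : ¬ RightComparable ω γ) :
    ∃ (i : Fin k) (s t : Fin (n i)) (ω' γ' σ : Words n), s ≠ t ∧ ω = consRight i s ω' * σ ∧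
      γ = consRight i t γ' * σ := by
  rw [RightComparable, not_forall] at h
  obtain ⟨i, h⟩ := h
  rcases comparable_or_exists (ω i) (γ i) with h' | ⟨u, v, τ, s, t, hst, hu, hv⟩
  · exact absurd h' h
  -- Only component `i` is shortened; the suffix `σ` is trivial in all the others.
  · refine ⟨i, s, t, Function.update ω i u, Function.update γ i v, Pi.mulSingle i τ, hst, ?_, ?_⟩
    · funext l
      by_cases hl : l = i
      · subst hl; simp [consRight, hu]
      · simp [consRight, hl]
    · funext l
      by_cases hl : l = i
      · subst hl; simp [consRight, hv]
      · simp [consRight, hl]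

end Words

/-! ### Left creation operators of words -/

section WordOp

variable {k : ℕ} {n : Fin k → ℕ}

/-- The isometry `e_γ ↦ e_{αγ}`. -/
def wordShift (α : Words n) : Fock n →L[ℂ] Fock n :=
  (wordIsometry (α * ·) (mul_right_injective α)).toContinuousLinearMap

theorem wordShift_basisVec (α γ : Words n) :
    wordShift α (basisVec γ) = basisVec (α * γ) :=
  wordIsometry_basisVec _ (mul_right_injective α) γ

theorem wordShift_one : wordShift (1 : Words n) = 1 :=
  clm_ext_basisVec fun γ => by rw [wordShift_basisVec, one_mul]; rfl

theorem wordShift_mul (α β : Words n) : wordShift (α * β) = wordShift α * wordShift β :=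
  clm_ext_basisVec fun γ => by
    rw [mul_apply_eq_comp, wordShift_basisVec, wordShift_basisVec, wordShift_basisVec,
      mul_assoc]

theorem leftCreation_eq (i : Fin k) (j : Fin (n i)) :
    leftCreation i j = wordShift (Pi.mulSingle i (FreeMonoid.of j)) :=
  clm_ext_basisVec fun γ => by
    rw [wordShift_basisVec, leftCreation_basisVec, consLeft_eq]

theorem lift_leftCreation (i : Fin k) (w : FreeMonoid (Fin (n i))) :
    FreeMonoid.lift (leftCreation i) w = wordShift (Pi.mulSingle i w : Words n) := by
  induction w using FreeMonoid.recOn with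
  | one => rw [map_one, Pi.mulSingle_one, wordShift_one]
  | of_mul j w ih =>
    rw [map_mul, ih, FreeMonoid.lift_eval_of, leftCreation_eq, Pi.mulSingle_mul, wordShift_mul]

/-- The factors lie in different components, so every enumeration of the components gives the same
product. This matters because adjoints reverse the order. -/
theorem prod_map_mulSingle (α : Words n) {l : List (Fin k)} (hl : l.Nodup)
    (hl' : ∀ i, i ∈ l) : (l.map fun i => (Pi.mulSingle i (α i) : Words n)).prod = α := by
  have key : ∀ l : List (Fin k), l.Nodup → ∀ j,
      (l.map fun i => (Pi.mulSingle i (α i) : Words n)).prod j = if j ∈ l then α j else 1 := by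
    intro l
    induction l with
    | nil => simp
    | cons i l ih =>
      intro h j
      rw [List.nodup_cons] at h
      rw [List.map_cons, List.prod_cons, Pi.mul_apply, ih h.2 j]
      by_cases hj : j = i
      · subst hj; simp [h.1]
      · simp [hj]
  funext j
  rw [key l hl j, if_pos (hl' j)]

theorem prod_map_wordShift (α : Words n) (l : List (Fin k)) :
    (l.map fun i => wordShift (Pi.mulSingle i (α i) : Words n)).prod
      = wordShift ((l.map fun i => (Pi.mulSingle i (α i) : Words n)).prod) := by
  induction l with
  | nil => simp [wordShift_one]
  | cons i l ih => rw [List.map_cons, List.prod_cons, ih, ← wordShift_mul]; rfl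

theorem prod_map_adjoint {ι H : Type*} [NormedAddCommGroup H] [InnerProductSpace ℂ H]
    [CompleteSpace H] (T : ι → H →L[ℂ] H) (l : List ι) :
    (l.map fun i => ContinuousLinearMap.adjoint (T i)).prod
      = ContinuousLinearMap.adjoint (l.reverse.map T).prod := by
  induction l with
  | nil => simp [← ContinuousLinearMap.star_eq_adjoint]
  | cons i l ih =>
    rw [List.map_cons, List.prod_cons, ih]
    simp only [List.reverse_cons, List.map_append, List.prod_append, List.map_cons,
      List.map_nil, List.prod_cons, List.prod_nil, mul_one, ← ContinuousLinearMap.star_eq_adjoint,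
      star_mul]

theorem wordOp_leftCreation (α : Words n) : wordOp leftCreation α = wordShift α := by
  simp only [wordOp, lift_leftCreation, List.ofFn_eq_map]
  rw [prod_map_wordShift, prod_map_mulSingle α (List.nodup_finRange k) (by simp)]

theorem wordOpStar_leftCreation (β : Words n) :
    wordOpStar leftCreation β = ContinuousLinearMap.adjoint (wordShift β) := by
  simp only [wordOpStar, lift_leftCreation, List.ofFn_eq_map]
  rw [prod_map_adjoint, prod_map_wordShift,
    prod_map_mulSingle β (List.nodup_reverse.2 (List.nodup_finRange k)) (by simp)]

theorem wordOpStar_scaledShift (r : ℝ) (β : Words n) :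
    wordOpStar (scaledShift n r) β
      = (r : ℂ) ^ len β • ContinuousLinearMap.adjoint (wordShift β) := by
  have h1 : ∀ (i : Fin k) (w : FreeMonoid (Fin (n i))), FreeMonoid.lift (scaledShift n r i) w
      = (r : ℂ) ^ w.length • FreeMonoid.lift (leftCreation i) w := by
    intro i w
    induction w using FreeMonoid.recOn with
    | one => simp
    | of_mul j w ih =>
      rw [map_mul, map_mul, ih, FreeMonoid.lift_eval_of, FreeMonoid.lift_eval_of,
        FreeMonoid.length_mul, FreeMonoid.length_of, pow_add, pow_one, scaledShift,
        smul_mul_smul_comm]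
  have h2 : ∀ l : List (Fin k),
      (l.map fun i => ContinuousLinearMap.adjoint (FreeMonoid.lift (scaledShift n r i) (β i))).prod
      = (r : ℂ) ^ (l.map fun i => (β i).length).sum •
        (l.map fun i => ContinuousLinearMap.adjoint
          (FreeMonoid.lift (leftCreation i) (β i))).prod := by
    intro l
    induction l with
    | nil => simp
    | cons i l ih =>
      rw [List.map_cons, List.prod_cons, ih, h1, List.map_cons, List.sum_cons, List.map_cons,
        List.prod_cons, pow_add, map_smulₛₗ, smul_mul_smul_comm]
      simp
  rw [← wordOpStar_leftCreation, wordOpStar, wordOpStar, List.ofFn_eq_map, List.ofFn_eq_map, h2,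
    len, ← List.ofFn_eq_map, List.sum_ofFn]

theorem adjoint_wordShift_mul (β σ : Words n) :
    ContinuousLinearMap.adjoint (wordShift β) (basisVec (β * σ)) = basisVec σ := by
  refine ext_inner_left ℂ fun y => ?_
  rw [ContinuousLinearMap.adjoint_inner_right, ← wordShift_basisVec]
  exact LinearIsometry.inner_map_map _ _ _

theorem adjoint_wordShift_of_forall_ne {β γ : Words n} (h : ∀ σ, γ ≠ β * σ) :
    ContinuousLinearMap.adjoint (wordShift β) (basisVec γ) = 0 := by
  have : (innerSL ℂ (basisVec γ)) ∘L wordShift β = 0 := clm_ext_basisVec fun σ => by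
    rw [ContinuousLinearMap.comp_apply, wordShift_basisVec, innerSL_apply_apply,
      orthonormal_basisVec.2 (h σ)]
    rfl
  refine ext_inner_right ℂ fun y => ?_
  rw [ContinuousLinearMap.adjoint_inner_left, inner_zero_left]
  exact DFunLike.congr_fun this y

/-- `𝐒_α` and `𝐒_β^*` commute if `α` and `β` are supported in different components. -/
theorem Disj.wordShift_comm {α β : Words n} (h : Disj α β) :
    wordShift α * ContinuousLinearMap.adjoint (wordShift β)
      = ContinuousLinearMap.adjoint (wordShift β) * wordShift α := by
  classical
  have hc : ∀ σ, α * (β * σ) = β * (α * σ) := fun σ => funext fun i => by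
    rcases h i with h | h <;> simp [h]
  refine clm_ext_basisVec fun γ => ?_
  rw [mul_apply_eq_comp, mul_apply_eq_comp, wordShift_basisVec]
  by_cases hγ : ∃ σ, γ = β * σ
  · obtain ⟨σ, rfl⟩ := hγ
    rw [adjoint_wordShift_mul, wordShift_basisVec, hc, adjoint_wordShift_mul]
  · push Not at hγ
    rw [adjoint_wordShift_of_forall_ne hγ, map_zero, adjoint_wordShift_of_forall_ne]
    intro σ hσ
    -- From `α * γ = β * σ`: where `α i` is empty, `γ i = β i * σ i`; elsewhere `β i` is empty and
    -- `γ i` is its own quotient. So `γ` would be a left multiple of `β` after all.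
    refine hγ (fun i => if α i = 1 then σ i else γ i) (funext fun i => ?_)
    have := congrFun hσ i
    rcases h i with h | h
    · simpa [h] using this
    · by_cases ha : α i = 1
      · simpa [ha, h] using this
      · simp [ha, h]

end WordOp

/-! ### Entries of Toeplitz operators and of formal series -/

section Toeplitz

variable {k : ℕ} {n : Fin k → ℕ}
variable {E : Type*} [NormedAddCommGroup E] [InnerProductSpace ℂ E]

open Classical in
/-- The matrix entries of the formal series `φ(r𝐒)` with coefficients `a`. -/
def toep (a : Words n → Words n → E →L[ℂ] E) (r : ℝ) (ω γ : Words n) : E →L[ℂ] E :=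
  if RightComparable ω γ then
    ((r : ℂ) ^ ∑ i, (deg ω γ i).natAbs) • a (cP ω γ) (cM ω γ) else 0

theorem toep_one (a : Words n → Words n → E →L[ℂ] E) {ω γ : Words n}
    (h : RightComparable ω γ) : toep a 1 ω γ = a (cP ω γ) (cM ω γ) := by
  rw [toep, if_pos h]; simp

theorem toep_eq_smul (a : Words n → Words n → E →L[ℂ] E) (r : ℝ) (ω γ : Words n) :
    toep a r ω γ = ((r : ℂ) ^ ∑ i, (deg ω γ i).natAbs) • toep a 1 ω γ := by
  by_cases h : RightComparable ω γ
  · rw [toep_one a h, toep, if_pos h]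
  · simp [toep, if_neg h]

variable [CompleteSpace E]

theorem fourierCoeff_comp_rightCreation (i : Fin k) (s t : Fin (n i))
    (A : HTensor E (Fock n) →L[ℂ] HTensor E (Fock n)) (ω γ : Words n) :
    fourierCoeff (tmap (ContinuousLinearMap.id ℂ E)
      (ContinuousLinearMap.adjoint (rightCreation i s)) ∘L A ∘L
        tmap (ContinuousLinearMap.id ℂ E) (rightCreation i t)) ω γ
      = fourierCoeff A (consRight i s ω) (consRight i t γ) := by
  ext1 h
  refine ext_inner_left ℂ fun l => ?_
  have : tmap (ContinuousLinearMap.id ℂ E) (ContinuousLinearMap.adjoint (rightCreation i s))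
      = ContinuousLinearMap.adjoint (tmap (ContinuousLinearMap.id ℂ E) (rightCreation i s)) := by
    rw [adjoint_tmap]; congr 1
    exact (ContinuousLinearMap.adjoint_id).symm
  rw [inner_fourierCoeff, inner_fourierCoeff, this, ContinuousLinearMap.comp_apply,
    ContinuousLinearMap.adjoint_inner_right, tmap_tmul, ContinuousLinearMap.comp_apply, tmap_tmul,
    rightCreation_basisVec, rightCreation_basisVec]
  rfl

theorem fourierCoeff_zero (ω γ : Words n) :
    fourierCoeff (0 : HTensor E (Fock n) →L[ℂ] HTensor E (Fock n)) ω γ = 0 := by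
  ext1 h
  simp [fourierCoeff_apply]

theorem isMultiToeplitz_iff {A : HTensor E (Fock n) →L[ℂ] HTensor E (Fock n)} :
    IsMultiToeplitz A ↔ ∀ (i : Fin k) (s t : Fin (n i)) (ω γ : Words n),
      fourierCoeff A (consRight i s ω) (consRight i t γ)
        = if s = t then fourierCoeff A ω γ else 0 := by
  constructor
  · intro h i s t ω γ
    rw [← fourierCoeff_comp_rightCreation, h i s t]
    split_ifs
    · rfl
    · exact fourierCoeff_zero ω γ
  · intro h i s t
    refine clm_ext_fourierCoeff fun ω γ => ?_
    rw [fourierCoeff_comp_rightCreation, h]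
    split_ifs
    · rfl
    · exact (fourierCoeff_zero ω γ).symm

/-- The Toeplitz relation with `s = t` cancels one common last letter; the suffix `σ` is removed
letter by letter, component by component. -/
theorem IsMultiToeplitz.fourierCoeff_mul {A : HTensor E (Fock n) →L[ℂ] HTensor E (Fock n)}
    (hA : IsMultiToeplitz A) (ω γ σ : Words n) :
    fourierCoeff A (ω * σ) (γ * σ) = fourierCoeff A ω γ := by
  rw [isMultiToeplitz_iff] at hA
  have h1 : ∀ (i : Fin k) (w : FreeMonoid (Fin (n i))) (ω γ : Words n),
      fourierCoeff A (ω * Pi.mulSingle i w) (γ * Pi.mulSingle i w) = fourierCoeff A ω γ := by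
    intro i w
    induction w using FreeMonoid.recOn with
    | one => simp
    | of_mul j w ih =>
      intro ω γ
      rw [Pi.mulSingle_mul, ← mul_assoc, ← mul_assoc, ih, ← consRight_eq, ← consRight_eq, hA,
        if_pos rfl]
  have h2 : ∀ (l : List (Fin k)) (ω γ : Words n),
      fourierCoeff A (ω * (l.map fun i => (Pi.mulSingle i (σ i) : Words n)).prod)
        (γ * (l.map fun i => (Pi.mulSingle i (σ i) : Words n)).prod) = fourierCoeff A ω γ := by
    intro l
    induction l with
    | nil => simp
    | cons i l ih =>
      intro ω γ
      rw [List.map_cons, List.prod_cons, ← mul_assoc, ← mul_assoc, ih, h1]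
  have := h2 (List.finRange k) ω γ
  rwa [prod_map_mulSingle σ (List.nodup_finRange k) (by simp)] at this

theorem IsMultiToeplitz.fourierCoeff_eq_zero {A : HTensor E (Fock n) →L[ℂ] HTensor E (Fock n)}
    (hA : IsMultiToeplitz A) {ω γ : Words n} (h : ¬ RightComparable ω γ) :
    fourierCoeff A ω γ = 0 := by
  obtain ⟨i, s, t, ω', γ', σ, hst, rfl, rfl⟩ := exists_of_not_rightComparable h
  rw [hA.fourierCoeff_mul, isMultiToeplitz_iff.1 hA, if_neg hst]

/-- A bounded operator is multi-Toeplitz with a given formal Fourier series if and only if its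
matrix entries are those of the series at `r = 1`. -/
theorem isMultiToeplitz_and_isFourierSeries_iff {a : Words n → Words n → E →L[ℂ] E}
    {A : HTensor E (Fock n) →L[ℂ] HTensor E (Fock n)} :
    IsMultiToeplitz A ∧ IsFourierSeries a A ↔ ∀ ω γ, fourierCoeff A ω γ = toep a 1 ω γ := by
  constructor
  · rintro ⟨hA, ha⟩ ω γ
    by_cases h : RightComparable ω γ
    · obtain ⟨hd, σ, h1, h2⟩ := h.exists_eq_mul
      rw [toep_one a h, ha _ _ (isIndex_iff.2 hd)]
      have := hA.fourierCoeff_mul (cP ω γ) (cM ω γ) σ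
      rwa [← h1, ← h2] at this
    · rw [hA.fourierCoeff_eq_zero h, toep, if_neg h]
  · intro h
    constructor
    · rw [isMultiToeplitz_iff]
      intro i s t ω γ
      rw [h, h]
      split_ifs with hst
      · subst hst
        rw [consRight_eq, consRight_eq]
        by_cases hc : RightComparable ω γ
        · rw [toep_one a hc, toep_one a (rightComparable_mul_iff.2 hc), (hc.cP_mul _).1,
            (hc.cP_mul _).2]
        · rw [toep, toep, if_neg hc, if_neg (mt rightComparable_mul_iff.1 hc)]
      · rw [toep, if_neg (not_rightComparable_consRight hst ω γ)]
    · intro α β hi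
      have hd := (isIndex_iff.1 hi).comparable 1
      simp only [mul_one] at hd
      rw [h, toep_one a hd.1, hd.2.1, hd.2.2]

open Classical in
-- The term of `(α; β)` has a nonzero scalar at `(ω, γ)` only if `ω = α * σ` and `γ = β * σ` for
-- some `σ`. For an index this forces `α = cP ω γ` and `β = cM ω γ`, so at most one term of the
-- block contributes, and only in the block of degree `deg ω γ`.
theorem fourierCoeff_block (a : Words n → Words n → E →L[ℂ] E) (r : ℝ) (m : Fin k → ℤ)
    (ω γ : Words n) :
    fourierCoeff (block a r m) ω γ = if deg ω γ = m then toep a r ω γ else 0 := by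
  have hsum : fourierCoeff (block a r m) ω γ = ∑ q ∈ (finite_hasDegree m).toFinset,
      ((r : ℂ) ^ (∑ i, ((q.1 i).length + (q.2 i).length)) *
        ((wordShift q.1 (ContinuousLinearMap.adjoint (wordShift q.2) (basisVec γ))) ω))
          • a q.1 q.2 := by
    ext1 h
    rw [fourierCoeff_apply, block]
    simp only [sum_apply, map_sum]
    refine Finset.sum_congr rfl fun q _ => ?_
    rw [← fourierCoeff_apply, fourierCoeff_tmap, wordOp_leftCreation, wordOpStar_leftCreation]
    rfl
  have hzero : ∀ α β : Words n, ¬ (∃ σ, ω = α * σ ∧ γ = β * σ) →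
      (wordShift α (ContinuousLinearMap.adjoint (wordShift β) (basisVec γ))) ω = 0 := by
    intro α β h
    by_cases hγ : ∃ σ, γ = β * σ
    · obtain ⟨σ, rfl⟩ := hγ
      rw [adjoint_wordShift_mul, wordShift_basisVec]
      exact basisVec_apply_ne fun h' => h ⟨σ, h', rfl⟩
    · push Not at hγ
      rw [adjoint_wordShift_of_forall_ne hγ, map_zero]
      rfl
  rw [hsum]
  by_cases hc : RightComparable ω γ ∧ deg ω γ = m
  · obtain ⟨hc, hm⟩ := hc
    obtain ⟨hd, σ, h1, h2⟩ := hc.exists_eq_mul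
    have hmem : HasDegree m (cP ω γ) (cM ω γ) := hasDegree_iff.2 ⟨hd, hc.deg_eq.trans hm⟩
    rw [Finset.sum_eq_single_of_mem (cP ω γ, cM ω γ) (by simpa using hmem), if_pos hm, toep,
      if_pos hc]
    · have : (wordShift (cP ω γ) (ContinuousLinearMap.adjoint (wordShift (cM ω γ))
          (basisVec γ))) ω = 1 := by
        have h3 := adjoint_wordShift_mul (cM ω γ) σ
        rw [← h2] at h3
        rw [h3, wordShift_basisVec, ← h1, basisVec_apply_self]
      rw [this, mul_one, Finset.sum_add_distrib, ← hc.deg_eq, ← hd.len_add_len]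
      rfl
    · rintro ⟨α, β⟩ hq hne
      have hq' : HasDegree m α β := by simpa using hq
      rw [hzero, mul_zero, zero_smul]
      rintro ⟨σ, rfl, rfl⟩
      have := (hasDegree_iff.1 hq').1.comparable σ
      exact hne (by rw [this.2.1, this.2.2])
  · have : (if deg ω γ = m then toep a r ω γ else 0) = 0 := by
      split_ifs with hm
      · rw [toep, if_neg fun h => hc ⟨h, hm⟩]
      · rfl
    rw [this]
    refine Finset.sum_eq_zero fun q hq => ?_
    have hq' : HasDegree m q.1 q.2 := by simpa using hq
    rw [hasDegree_iff] at hq'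
    rw [hzero, mul_zero, zero_smul]
    rintro ⟨σ, rfl, rfl⟩
    exact hc ⟨(hq'.1.comparable σ).1, by rw [deg_mul_mul, hq'.2]⟩

end Toeplitz

/-! ### The defect operator and the Berezin kernel of `r𝐒` -/

section Diagonal

variable {k : ℕ} {n : Fin k → ℕ}

theorem exists_diagonal (f : Words n → ℝ) (hf : ∀ γ, |f γ| ≤ 1) :
    ∃ D : Fock n →L[ℂ] Fock n, ∀ x γ, D x γ = f γ * x γ := by
  have hle : ∀ (x : Fock n) γ, ‖(f γ : ℂ) * x γ‖ ≤ ‖x γ‖ := fun x γ => by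
    rw [norm_mul, Complex.norm_real]
    exact mul_le_of_le_one_left (norm_nonneg _) (hf γ)
  have hm : ∀ x : Fock n, Memℓp (fun γ => (f γ : ℂ) * x γ) 2 := fun x =>
    (lp.memℓp x).mono' fun γ => hle x γ
  let D : Fock n →ₗ[ℂ] Fock n :=
    { toFun := fun x => ⟨fun γ => (f γ : ℂ) * x γ, hm x⟩
      map_add' := fun x y => by ext γ; exact mul_add _ _ _
      map_smul' := fun c x => by ext γ; exact mul_left_comm _ _ _ }
  refine ⟨D.mkContinuous 1 fun x => ?_, fun x γ => rfl⟩
  rw [one_mul]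
  exact lp.norm_mono (by norm_num) fun γ => hle x γ

theorem diagonal_basisVec {D : Fock n →L[ℂ] Fock n} {f : Words n → ℝ}
    (hD : ∀ x γ, D x γ = f γ * x γ) (γ : Words n) :
    D (basisVec γ) = (f γ : ℂ) • basisVec γ := by
  ext ω
  rw [hD]
  by_cases h : ω = γ
  · subst h; rfl
  · have h0 := basisVec_apply_ne h
    rw [h0, mul_zero]
    exact (mul_eq_zero_of_right _ h0).symm

/-- A diagonal operator with real entries is self-adjoint, so its square has the form `D^* D`. -/
theorem diagonal_mul_self_nonneg {D : Fock n →L[ℂ] Fock n} {g : Words n → ℝ}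
    (hg : ∀ x γ, D x γ = g γ * x γ) : 0 ≤ D * D := by
  have hs : star D = D := by
    refine clm_ext_basisVec fun γ => ext_inner_left ℂ fun y => ?_
    rw [ContinuousLinearMap.star_eq_adjoint, ContinuousLinearMap.adjoint_inner_right,
      diagonal_basisVec hg, inner_smul_right, ← inner_conj_symm, ← inner_conj_symm y,
      inner_basisVec, inner_basisVec, hg]
    simp
  nth_rewrite 1 [← hs]
  rw [ContinuousLinearMap.nonneg_iff_isPositive, ContinuousLinearMap.star_eq_adjoint]
  exact ContinuousLinearMap.isPositive_adjoint_comp_self D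

/-- The eigenvalues of the defect operator of `r𝐒`. -/
def defectValue (r : ℝ) (γ : Words n) : ℝ := ∏ i, if (γ i).length = 0 then 1 else 1 - r ^ 2

theorem defectValue_nonneg {r : ℝ} (h0 : 0 ≤ r) (h1 : r < 1) (γ : Words n) :
    0 ≤ defectValue r γ :=
  Finset.prod_nonneg fun i _ => by split_ifs <;> nlinarith

theorem defectValue_le_one {r : ℝ} (h0 : 0 ≤ r) (h1 : r < 1) (γ : Words n) :
    defectValue r γ ≤ 1 :=
  Finset.prod_le_one (fun i _ => by split_ifs <;> nlinarith) fun i _ => by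
    split_ifs <;> nlinarith

theorem adjoint_leftCreation_cons (i : Fin k) (j : Fin (n i)) (γ : Words n)
    (w : FreeMonoid (Fin (n i))) :
    ContinuousLinearMap.adjoint (leftCreation i j)
      (basisVec (Function.update γ i (FreeMonoid.of j * w)))
        = basisVec (Function.update γ i w) := by
  have : Function.update γ i (FreeMonoid.of j * w)
      = Pi.mulSingle i (FreeMonoid.of j) * Function.update γ i w := by
    rw [← consLeft_eq]; simp [consLeft]
  rw [this, leftCreation_eq, adjoint_wordShift_mul]

theorem adjoint_leftCreation_of_forall_ne (i : Fin k) (j : Fin (n i)) (γ : Words n)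
    (h : ∀ w, γ i ≠ FreeMonoid.of j * w) :
    ContinuousLinearMap.adjoint (leftCreation i j) (basisVec γ) = 0 := by
  rw [leftCreation_eq, adjoint_wordShift_of_forall_ne]
  intro σ hσ
  refine h (σ i) ?_
  have := congrFun hσ i
  simpa using this

/-- If `γ i` is empty, all `𝐒_{i,j}^*` annihilate `e_γ`. Otherwise only the first letter of `γ i`
contributes: it is removed and put back, and `Y` acts in between by an eigenvalue which, by `hy`,
does not notice the removal. -/
theorem cpMap_scaledShift_basisVec (r : ℝ) (i : Fin k) (Y : Fock n →L[ℂ] Fock n) (y : Words n → ℝ)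
    (hY : ∀ γ, Y (basisVec γ) = (y γ : ℂ) • basisVec γ)
    (hy : ∀ γ w, y (Function.update γ i w) = y γ) (γ : Words n) :
    cpMap (scaledShift n r) i Y (basisVec γ)
      = ((if (γ i).length = 0 then 0 else r ^ 2 : ℝ) * y γ : ℂ) • basisVec γ := by
  have h1 : cpMap (scaledShift n r) i Y (basisVec γ) = ∑ j, ((r : ℂ) ^ 2) • leftCreation i j
      (Y (ContinuousLinearMap.adjoint (leftCreation i j) (basisVec γ))) := by
    simp only [cpMap, LinearMap.sum_apply, sum_apply, LinearMap.mulLeftRight_apply, scaledShift,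
      mul_apply_eq_comp, map_smulₛₗ, smul_apply, smul_smul]
    refine Finset.sum_congr rfl fun j _ => ?_
    simp [sq]
  rw [h1]
  rcases hγ : FreeMonoid.toList (γ i) with _ | ⟨j, w⟩
  · have hγ' : γ i = 1 := hγ
    rw [Finset.sum_eq_zero]
    · simp [hγ']
    · intro j _
      rw [adjoint_leftCreation_of_forall_ne, map_zero, map_zero, smul_zero]
      intro w hw
      have := congrArg FreeMonoid.length hw
      simp [hγ'] at this
      omega
  · have hγ' : γ i = FreeMonoid.of j * FreeMonoid.ofList w := hγ
    have hupd : γ = Function.update γ i (FreeMonoid.of j * FreeMonoid.ofList w) := by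
      rw [← hγ', Function.update_eq_self]
    rw [Finset.sum_eq_single_of_mem j (Finset.mem_univ j)]
    · have h2 := adjoint_leftCreation_cons i j γ (FreeMonoid.ofList w)
      rw [← hupd] at h2
      rw [h2, hY, hy, map_smul, leftCreation_basisVec, smul_smul, if_neg (by rw [hγ']; simp)]
      have h3 : consLeft i j (Function.update γ i (FreeMonoid.ofList w)) = γ := by
        conv_rhs => rw [hupd]
        simp [consLeft]
      rw [h3]
      push_cast
      rfl
    · intro j' _ hne
      rw [adjoint_leftCreation_of_forall_ne, map_zero, map_zero, smul_zero]
      intro w' hw'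
      rw [hγ'] at hw'
      have := congrArg FreeMonoid.toList hw'
      simp only [FreeMonoid.toList_mul, FreeMonoid.toList_of, List.singleton_append,
        List.cons.injEq] at this
      exact hne this.1.symm

theorem defect_basisVec (r : ℝ) (γ : Words n) :
    defect (scaledShift n r) (basisVec γ) = (defectValue r γ : ℂ) • basisVec γ := by
  have key : ∀ l : List (Fin k), l.Nodup → ∀ γ : Words n,
      (l.map fun i => (1 - cpMap (scaledShift n r) i :
        Module.End ℂ (Fock n →L[ℂ] Fock n))).prod 1 (basisVec γ)
      = (((l.map fun i => if (γ i).length = 0 then (1 : ℝ) else 1 - r ^ 2).prod : ℝ) : ℂ) •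
        basisVec γ := by
    intro l
    induction l with
    | nil => intro _ γ; simp
    | cons i l ih =>
      intro hl γ
      rw [List.nodup_cons] at hl
      rw [List.map_cons, List.prod_cons, Module.End.mul_apply, LinearMap.sub_apply,
        Module.End.one_apply, sub_apply, ih hl.2,
        cpMap_scaledShift_basisVec r i _ _ (ih hl.2), List.map_cons, List.prod_cons, ← sub_smul]
      · congr 1
        split_ifs <;> push_cast <;> ring
      -- The remaining factors do not involve component `i`, since `i` does not recur in the list;
      -- this is the hypothesis `hy` of `cpMap_scaledShift_basisVec`.
      · intro γ w
        congr 1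
        refine List.map_congr_left fun l hl' => ?_
        rw [Function.update_of_ne]
        rintro rfl
        exact hl.1 hl'
  have := key (List.finRange k) (List.nodup_finRange k) γ
  rw [defect, List.ofFn_eq_map, this, ← List.ofFn_eq_map, List.prod_ofFn]
  rfl

/-- The square root `Δ_X(I)^{1/2}`. -/
def defectRoot {H : Type*} [NormedAddCommGroup H] [InnerProductSpace ℂ H] [CompleteSpace H]
    (X : OpTuple n H) : H →L[ℂ] H := CFC.sqrt (defect X)

theorem defectRoot_eq {H : Type*} [NormedAddCommGroup H] [InnerProductSpace ℂ H] [CompleteSpace H]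
    {X : OpTuple n H} {b : H →L[ℂ] H} (h : b * b = defect X) (hb : 0 ≤ b) : defectRoot X = b :=
  CFC.sqrt_unique h hb

theorem defectRoot_basisVec {r : ℝ} (h0 : 0 ≤ r) (h1 : r < 1) (γ : Words n) :
    defectRoot (scaledShift n r) (basisVec γ)
      = (Real.sqrt (defectValue r γ) : ℂ) • basisVec γ := by
  have hsq : ∀ γ : Words n, |√(defectValue r γ)| ≤ 1 := fun γ => by
    rw [abs_of_nonneg (Real.sqrt_nonneg _)]
    exact Real.sqrt_le_one.2 (defectValue_le_one h0 h1 γ)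
  have hsq' : ∀ γ : Words n, |√√(defectValue r γ)| ≤ 1 := fun γ => by
    rw [abs_of_nonneg (Real.sqrt_nonneg _)]
    exact Real.sqrt_le_one.2 (le_of_abs_le (hsq γ))
  obtain ⟨D, hD⟩ := exists_diagonal _ hsq
  obtain ⟨D', hD'⟩ := exists_diagonal _ hsq'
  -- `D` is the expected root. Being the square of the real diagonal operator `D'`, it is
  -- nonnegative, and uniqueness of the nonnegative square root identifies it.
  have e1 : D = D' * D' := clm_ext_basisVec fun γ => by
    rw [mul_apply_eq_comp, diagonal_basisVec hD', map_smul, diagonal_basisVec hD',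
      diagonal_basisVec hD, smul_smul, ← Complex.ofReal_mul,
      Real.mul_self_sqrt (Real.sqrt_nonneg _)]
  have e2 : D * D = defect (scaledShift n r) := clm_ext_basisVec fun γ => by
    rw [mul_apply_eq_comp, diagonal_basisVec hD, map_smul, diagonal_basisVec hD,
      defect_basisVec, smul_smul, ← Complex.ofReal_mul,
      Real.mul_self_sqrt (defectValue_nonneg h0 h1 γ)]
  rw [defectRoot_eq e2 (e1 ▸ diagonal_mul_self_nonneg hD'), diagonal_basisVec hD]

end Diagonal

/-! ### Sums over suffixes -/

section Suffixes

theorem finite_suffixes {ι : Type*} (u : FreeMonoid ι) :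
    {y : FreeMonoid ι | ∃ x, u = x * y}.Finite := by
  refine (List.finite_toSet (FreeMonoid.toList u).tails).subset ?_
  rintro y ⟨x, rfl⟩
  exact (List.mem_tails _ _).2 ⟨FreeMonoid.toList x, rfl⟩

/-- The finite set of suffixes of a word. -/
def suffixes {ι : Type*} (u : FreeMonoid ι) : Finset (FreeMonoid ι) := (finite_suffixes u).toFinset

theorem mem_suffixes {ι : Type*} {u y : FreeMonoid ι} : y ∈ suffixes u ↔ ∃ x, u = x * y := by
  simp [suffixes]

/-- A telescoping sum: a word of length `L` gives `q ^ L + (1 - q) * (1 + q + ⋯ + q ^ (L - 1))`. In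
the induction a new first letter multiplies the old terms by `q` and adds the whole word as a
suffix, with weight `1 - q`. -/
theorem sum_suffixes {ι : Type*} (q : ℝ) (u : FreeMonoid ι) :
    ∑ y ∈ suffixes u, q ^ (cPlus u y).length * (if y.length = 0 then 1 else 1 - q) = 1 := by
  classical
  induction u using FreeMonoid.recOn with
  | one =>
    have : suffixes (1 : FreeMonoid ι) = {1} := by
      ext y
      rw [mem_suffixes, Finset.mem_singleton]
      constructor
      · rintro ⟨x, hx⟩
        have := congrArg FreeMonoid.length hx
        simp only [FreeMonoid.length_one, FreeMonoid.length_mul] at this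
        exact FreeMonoid.length_eq_zero.1 (by omega)
      · rintro rfl
        exact ⟨1, rfl⟩
    rw [this, Finset.sum_singleton]
    have := cPlus_mul 1 (1 : FreeMonoid ι)
    rw [one_mul] at this
    simp [this]
  | of_mul a u ih =>
    have hins : suffixes (FreeMonoid.of a * u) = insert (FreeMonoid.of a * u) (suffixes u) := by
      ext y
      rw [mem_suffixes, Finset.mem_insert, mem_suffixes]
      constructor
      · rintro ⟨x, hx⟩
        induction x using FreeMonoid.casesOn with
        | one => left; rw [hx, one_mul]
        | of_mul b x =>
          right
          rw [mul_assoc] at hx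
          exact ⟨x, (List.cons.inj hx).2⟩
      · rintro (rfl | ⟨x, rfl⟩)
        · exact ⟨1, (one_mul _).symm⟩
        · exact ⟨FreeMonoid.of a * x, (mul_assoc _ _ _).symm⟩
    have hnot : FreeMonoid.of a * u ∉ suffixes u := by
      rw [mem_suffixes]
      rintro ⟨x, hx⟩
      have := congrArg FreeMonoid.length hx
      simp only [FreeMonoid.length_mul, FreeMonoid.length_of] at this
      omega
    have hself := cPlus_mul 1 (FreeMonoid.of a * u)
    rw [one_mul] at hself
    rw [hins, Finset.sum_insert hnot, hself]
    have hstep : ∑ y ∈ suffixes u, q ^ (cPlus (FreeMonoid.of a * u) y).length *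
        (if y.length = 0 then 1 else 1 - q)
        = q * ∑ y ∈ suffixes u, q ^ (cPlus u y).length *
          (if y.length = 0 then 1 else 1 - q) := by
      rw [Finset.mul_sum]
      refine Finset.sum_congr rfl fun y hy => ?_
      obtain ⟨x, rfl⟩ := mem_suffixes.1 hy
      rw [← mul_assoc, cPlus_mul, cPlus_mul, FreeMonoid.length_mul, FreeMonoid.length_of, pow_add,
        pow_one, mul_assoc]
    rw [hstep, ih]
    simp

variable {k : ℕ} {n : Fin k → ℕ}

/-- The finite set of suffixes of a tuple of words. -/
def wordSuffixes (γ : Words n) : Finset (Words n) := Fintype.piFinset fun i => suffixes (γ i)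

theorem mem_wordSuffixes {γ σ : Words n} : σ ∈ wordSuffixes γ ↔ ∃ β, γ = β * σ := by
  simp only [wordSuffixes, Fintype.mem_piFinset, mem_suffixes]
  constructor
  · intro h
    choose β hβ using h
    exact ⟨β, funext hβ⟩
  · rintro ⟨β, rfl⟩ i
    exact ⟨β i, rfl⟩

theorem cP_mul_self (β σ : Words n) : cP (β * σ) σ = β := funext fun i => cPlus_mul (β i) (σ i)

/-- The product over the components of `sum_suffixes` with `q = r ^ 2`. -/
theorem sum_wordSuffixes (r : ℝ) (τ : Words n) :
    ∑ σ ∈ wordSuffixes τ, r ^ (2 * len (cP τ σ)) * defectValue r σ = 1 := by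
  have : ∀ σ : Words n, r ^ (2 * len (cP τ σ)) * defectValue r σ
      = ∏ i, (r ^ 2) ^ (cPlus (τ i) (σ i)).length *
        (if (σ i).length = 0 then 1 else 1 - r ^ 2) := fun σ => by
    rw [Finset.prod_mul_distrib, Finset.prod_pow_eq_pow_sum, ← pow_mul]
    rfl
  simp only [this, wordSuffixes]
  rw [← Finset.prod_univ_sum (fun i => suffixes (τ i)) fun i y =>
    (r ^ 2) ^ (cPlus (τ i) y).length * (if y.length = 0 then 1 else 1 - r ^ 2)]
  exact Finset.prod_eq_one fun i _ => sum_suffixes (r ^ 2) (τ i)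

end Suffixes

/-! ### The Berezin kernel as an isometry, and the Berezin transform of a Toeplitz operator -/

section BerezinKernel

variable {k : ℕ} {n : Fin k → ℕ}

theorem sum_sum_mul_inner_basisVec [DecidableEq (Words n)] (S T : Finset (Words n))
    (f : Words n → Words n → ℂ) :
    ∑ σ' ∈ S, ∑ σ ∈ T, f σ' σ * ⟪(basisVec σ' : Fock n), basisVec σ⟫_ℂ
      = ∑ σ ∈ S ∩ T, f σ σ := by
  simp only [orthonormal_iff_ite.1 orthonormal_basisVec, mul_ite, mul_one, mul_zero,
    Finset.sum_ite_eq, Finset.sum_ite_mem]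

/-- The coefficients of `K_{r𝐒} e_γ`. -/
def berezinWeight (r : ℝ) (γ σ : Words n) : ℝ := r ^ len (cP γ σ) * √(defectValue r σ)

/-- The vector `K_{r𝐒} e_γ`. -/
def berezinVec (r : ℝ) (γ : Words n) : HTensor (Fock n) (Fock n) :=
  ∑ σ ∈ wordSuffixes γ, (berezinWeight r γ σ : ℂ) • tmul (basisVec (cP γ σ)) (basisVec σ)

/-- As `α i` or `β i` is empty for each `i`, the common suffixes of `α * τ` and `β * τ` are the
suffixes of `τ`. The factor `r ^ (len α + len β)` comes out, and `sum_wordSuffixes` evaluates the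
rest to `1`. -/
theorem sum_berezinWeight_mul {r : ℝ} (h0 : 0 ≤ r) (h1 : r < 1) [DecidableEq (Words n)]
    {α β : Words n} (h : Disj α β) (τ : Words n) :
    ∑ σ ∈ wordSuffixes (α * τ) ∩ wordSuffixes (β * τ),
      berezinWeight r (α * τ) σ * berezinWeight r (β * τ) σ = r ^ (len α + len β) := by
  have hs : wordSuffixes (α * τ) ∩ wordSuffixes (β * τ) = wordSuffixes τ := by
    ext σ
    simp only [Finset.mem_inter, wordSuffixes, Fintype.mem_piFinset, Pi.mul_apply, ← forall_and]
    refine forall_congr' fun i => ?_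
    have hm : ∀ a t : FreeMonoid (Fin (n i)), σ i ∈ suffixes t → σ i ∈ suffixes (a * t) := by
      intro a t ht
      obtain ⟨x, hx⟩ := mem_suffixes.1 ht
      exact mem_suffixes.2 ⟨a * x, by rw [hx, mul_assoc]⟩
    rcases h i with h | h <;> rw [h, one_mul]
    · exact ⟨fun h => h.1, fun h => ⟨h, hm _ _ h⟩⟩
    · exact ⟨fun h => h.2, fun h => ⟨hm _ _ h, h⟩⟩
  rw [hs, ← mul_one (r ^ _), ← sum_wordSuffixes r τ, Finset.mul_sum]
  refine Finset.sum_congr rfl fun σ hσ => ?_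
  obtain ⟨x, rfl⟩ := mem_wordSuffixes.1 hσ
  have hd := Real.mul_self_sqrt (defectValue_nonneg h0 h1 σ)
  simp only [berezinWeight]
  rw [← mul_assoc α, ← mul_assoc β, cP_mul_self, cP_mul_self, cP_mul_self, len_mul, len_mul]
  linear_combination (r ^ (len α + len x) * r ^ (len β + len x)) * hd

/-- Vectors `e_β ⊗ e_σ` occurring in the expansions of both `ω` and `γ` have `ω = β * σ = γ`, which
gives orthogonality; the norms are the case `α = β = 1` of `sum_berezinWeight_mul`. -/
theorem orthonormal_berezinVec {r : ℝ} (h0 : 0 ≤ r) (h1 : r < 1) :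
    Orthonormal ℂ (berezinVec r : Words n → HTensor (Fock n) (Fock n)) := by
  classical
  have key : ∀ ω γ : Words n, ⟪berezinVec r ω, berezinVec r γ⟫_ℂ
      = ∑ σ ∈ wordSuffixes ω ∩ wordSuffixes γ,
        ((berezinWeight r ω σ * berezinWeight r γ σ : ℝ) : ℂ) *
          ⟪(basisVec (cP ω σ) : Fock n), basisVec (cP γ σ)⟫_ℂ := by
    intro ω γ
    rw [← sum_sum_mul_inner_basisVec _ _ fun σ' σ =>
      ((berezinWeight r ω σ' * berezinWeight r γ σ : ℝ) : ℂ) *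
          ⟪(basisVec (cP ω σ') : Fock n), basisVec (cP γ σ)⟫_ℂ]
    simp only [berezinVec, sum_inner, inner_sum]
    rw [Finset.sum_comm]
    refine Finset.sum_congr rfl fun σ' _ => Finset.sum_congr rfl fun σ _ => ?_
    rw [inner_smul_left, inner_smul_right, inner_tmul, Complex.conj_ofReal]
    push_cast
    ring
  rw [orthonormal_iff_ite]
  intro ω γ
  rw [key]
  split_ifs with h
  · subst h
    have := sum_berezinWeight_mul h0 h1 (α := (1 : Words n)) (β := 1) (fun _ => Or.inl rfl) ω
    simp only [one_mul, len, Pi.one_apply, FreeMonoid.length_one, Finset.sum_const_zero, add_zero,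
      pow_zero] at this
    rw [← Complex.ofReal_one, ← this, Complex.ofReal_sum]
    refine Finset.sum_congr rfl fun σ _ => ?_
    rw [inner_self_eq_norm_sq_to_K, orthonormal_basisVec.1]
    simp
  · refine Finset.sum_eq_zero fun σ hσ => ?_
    rw [Finset.mem_inter, mem_wordSuffixes, mem_wordSuffixes] at hσ
    obtain ⟨⟨α, rfl⟩, ⟨β, rfl⟩⟩ := hσ
    rw [cP_mul_self, cP_mul_self, orthonormal_basisVec.2, mul_zero]
    rintro rfl
    exact h rfl

theorem exists_isometry_berezinVec {r : ℝ} (h0 : 0 ≤ r) (h1 : r < 1) :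
    ∃ K : Fock n →ₗᵢ[ℂ] HTensor (Fock n) (Fock n), ∀ γ, K (basisVec γ) = berezinVec r γ := by
  classical
  refine ⟨(orthonormal_berezinVec h0 h1).orthogonalFamily.linearIsometry, fun γ => ?_⟩
  simp only [basisVec]
  rw [OrthogonalFamily.linearIsometry_apply_single]
  simp

theorem leftCoord_berezinVec (r : ℝ) (β ω : Words n) :
    leftCoord β (berezinVec r ω)
      = ∑ σ ∈ wordSuffixes ω, (berezinWeight r ω σ : ℂ) •
          ((basisVec (cP ω σ) : Fock n) β • (basisVec σ : Fock n)) := by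
  simp only [berezinVec, map_sum, map_smul, leftCoord_tmul]

/-- The coordinate of `K e_ω` at `e_β` in the first factor comes from the only `σ` with `ω = β * σ`,
if there is one, and this is what `Δ^{1/2} (r𝐒)_β^*` produces from `e_ω`. -/
theorem isBerezinKernel_of_basisVec {r : ℝ} (h0 : 0 ≤ r) (h1 : r < 1)
    {K : Fock n →L[ℂ] HTensor (Fock n) (Fock n)} (hK : ∀ γ, K (basisVec γ) = berezinVec r γ) :
    IsBerezinKernel (scaledShift n r) K := by
  have key : ∀ β, leftCoord β ∘L K
      = defectRoot (scaledShift n r) ∘L wordOpStar (scaledShift n r) β := by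
    intro β
    refine clm_ext_basisVec fun ω => ?_
    rw [ContinuousLinearMap.comp_apply, ContinuousLinearMap.comp_apply, hK, leftCoord_berezinVec,
      wordOpStar_scaledShift, smul_apply]
    by_cases hω : ∃ σ, ω = β * σ
    · obtain ⟨σ, rfl⟩ := hω
      rw [adjoint_wordShift_mul, map_smul, defectRoot_basisVec h0 h1,
        Finset.sum_eq_single_of_mem σ (mem_wordSuffixes.2 ⟨β, rfl⟩), berezinWeight, cP_mul_self,
        basisVec_apply_self, one_smul, smul_smul]
      · push_cast; rfl
      · intro σ' hσ' hne
        obtain ⟨β', hβ'⟩ := mem_wordSuffixes.1 hσ'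
        rw [hβ', cP_mul_self, basisVec_apply_ne, zero_smul, smul_zero]
        rintro rfl
        exact hne (mul_left_cancel hβ').symm
    · push Not at hω
      rw [adjoint_wordShift_of_forall_ne hω, smul_zero, map_zero]
      refine Finset.sum_eq_zero fun σ' hσ' => ?_
      obtain ⟨β', hβ'⟩ := mem_wordSuffixes.1 hσ'
      rw [hβ', cP_mul_self, basisVec_apply_ne, zero_smul, smul_zero]
      rintro rfl
      exact hω _ hβ'
  intro h
  refine (hasSum_leftCoord (K h)).congr_fun fun β => ?_
  exact congrArg (tmul (basisVec β)) (DFunLike.congr_fun (key β) h).symm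

variable {E : Type*} [NormedAddCommGroup E] [InnerProductSpace ℂ E]

theorem tassoc_symm_berezinVec (r : ℝ) (h : E) (γ : Words n) :
    (tassoc E (Fock n) (Fock n)).symm (tmul h (berezinVec r γ))
      = ∑ σ ∈ wordSuffixes γ, (berezinWeight r γ σ : ℂ) •
          tmul (tmul h (basisVec (cP γ σ))) (basisVec σ) := by
  simp only [berezinVec, tmul_sum_right, tmul_smul_right, map_sum, map_smul, tassoc_symm_tmul]

variable [CompleteSpace E]

theorem norm_berezinExt_le (K : Fock n →ₗᵢ[ℂ] HTensor (Fock n) (Fock n))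
    (A : HTensor E (Fock n) →L[ℂ] HTensor E (Fock n)) :
    ‖berezinExt K.toContinuousLinearMap A‖ ≤ ‖A‖ := by
  have hK : ‖K.toContinuousLinearMap‖ ≤ 1 := K.norm_toContinuousLinearMap_le
  have h1 : ‖tmap (ContinuousLinearMap.id ℂ E) K.toContinuousLinearMap‖ ≤ 1 :=
    (norm_tmap_le _ _).trans (mul_le_one₀ ContinuousLinearMap.norm_id_le (norm_nonneg _) hK)
  have h2 : ‖tmap (ContinuousLinearMap.id ℂ E)
      (ContinuousLinearMap.adjoint K.toContinuousLinearMap)‖ ≤ 1 :=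
    (norm_tmap_le _ _).trans (mul_le_one₀ ContinuousLinearMap.norm_id_le (norm_nonneg _)
      (by rwa [LinearIsometryEquiv.norm_map]))
  have h3 : ‖tmap A (ContinuousLinearMap.id ℂ (Fock n))‖ ≤ ‖A‖ :=
    (norm_tmap_le _ _).trans (mul_le_of_le_one_right (norm_nonneg _)
      ContinuousLinearMap.norm_id_le)
  refine ContinuousLinearMap.opNorm_le_bound _ (norm_nonneg _) fun x => ?_
  calc ‖berezinExt K.toContinuousLinearMap A x‖ ≤ 1 * (‖A‖ * (1 * ‖x‖)) := by
        refine (ContinuousLinearMap.le_of_opNorm_le _ h2 _).trans ?_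
        gcongr
        refine (LinearIsometryEquiv.norm_map (tassoc E (Fock n) (Fock n)) _).trans_le ?_
        refine (ContinuousLinearMap.le_of_opNorm_le _ h3 _).trans ?_
        gcongr
        refine (LinearIsometryEquiv.norm_map (tassoc E (Fock n) (Fock n)).symm _).trans_le ?_
        exact ContinuousLinearMap.le_of_opNorm_le _ h1 _
    _ = _ := by ring

theorem inner_berezinExt (K : Fock n →L[ℂ] HTensor (Fock n) (Fock n))
    (A : HTensor E (Fock n) →L[ℂ] HTensor E (Fock n)) (l h : E) (x y : Fock n) :
    ⟪tmul l x, berezinExt K A (tmul h y)⟫_ℂ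
      = ⟪(tassoc E (Fock n) (Fock n)).symm (tmul l (K x)),
          tmap A (ContinuousLinearMap.id ℂ (Fock n))
            ((tassoc E (Fock n) (Fock n)).symm (tmul h (K y)))⟫_ℂ := by
  have hadj : tmap (ContinuousLinearMap.id ℂ E) (ContinuousLinearMap.adjoint K)
      = ContinuousLinearMap.adjoint (tmap (ContinuousLinearMap.id ℂ E) K) := by
    rw [adjoint_tmap, ContinuousLinearMap.adjoint_id]
  rw [berezinExt, hadj, ContinuousLinearMap.comp_apply, ContinuousLinearMap.adjoint_inner_right,
    tmap_tmul, ← LinearIsometryEquiv.inner_map_map (tassoc E (Fock n) (Fock n)).symm]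
  simp [tmap_tmul]

/-- The identity on the second tensor factor leaves only pairs of factorizations `ω = α * σ`, `γ = β
* σ` with the same `σ`. By the Toeplitz property each of them contributes the same entry of `A` at
`(ω, γ)`, times a product of weights; these products add up to the damping factor of `toep a r`. -/
theorem fourierCoeff_berezinExt {r : ℝ} (h0 : 0 ≤ r) (h1 : r < 1)
    {K : Fock n →L[ℂ] HTensor (Fock n) (Fock n)} (hK : ∀ γ, K (basisVec γ) = berezinVec r γ)
    {A : HTensor E (Fock n) →L[ℂ] HTensor E (Fock n)} (hA : IsMultiToeplitz A)
    {a : Words n → Words n → E →L[ℂ] E} (ha : IsFourierSeries a A) (ω γ : Words n) :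
    fourierCoeff (berezinExt K A) ω γ = toep a r ω γ := by
  classical
  have hent := isMultiToeplitz_and_isFourierSeries_iff.1 ⟨hA, ha⟩
  ext1 h
  refine ext_inner_left ℂ fun l => ?_
  have key : ⟪l, fourierCoeff (berezinExt K A) ω γ h⟫_ℂ
      = ((∑ σ ∈ wordSuffixes ω ∩ wordSuffixes γ,
        berezinWeight r ω σ * berezinWeight r γ σ : ℝ) : ℂ) * ⟪l, toep a 1 ω γ h⟫_ℂ := by
    rw [inner_fourierCoeff, inner_berezinExt, hK, hK, tassoc_symm_berezinVec,
      tassoc_symm_berezinVec]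
    simp only [map_sum, map_smul, tmap_tmul, sum_inner, inner_sum, inner_smul_left,
      inner_smul_right, inner_tmul, Complex.conj_ofReal, ContinuousLinearMap.id_apply]
    have := sum_sum_mul_inner_basisVec (wordSuffixes ω) (wordSuffixes γ) fun σ' σ =>
      (berezinWeight r ω σ' : ℂ) * (berezinWeight r γ σ : ℂ) *
        ⟪tmul l (basisVec (cP ω σ')), A (tmul h (basisVec (cP γ σ)))⟫_ℂ
    rw [Finset.sum_comm] at this
    calc _ = _ := ?_
      _ = _ := this
      _ = _ := ?_
    · refine Finset.sum_congr rfl fun σ _ => ?_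
      rw [Finset.mul_sum]
      refine Finset.sum_congr rfl fun σ' _ => ?_
      ring
    · rw [Complex.ofReal_sum, Finset.sum_mul]
      refine Finset.sum_congr rfl fun σ hσ => ?_
      rw [Finset.mem_inter, mem_wordSuffixes, mem_wordSuffixes] at hσ
      obtain ⟨⟨α, rfl⟩, ⟨β, rfl⟩⟩ := hσ
      rw [cP_mul_self, cP_mul_self, ← inner_fourierCoeff, ← hent, hA.fourierCoeff_mul]
      push_cast
      ring
  rw [key]
  by_cases hc : RightComparable ω γ
  · obtain ⟨hd, τ, h2, h3⟩ := hc.exists_eq_mul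
    have hsum := sum_berezinWeight_mul h0 h1 hd τ
    rw [← h2, ← h3, hd.len_add_len, hc.deg_eq] at hsum
    rw [hsum, toep_eq_smul a r, smul_apply, inner_smul_right]
    push_cast
    rfl
  · rw [toep, toep, if_neg hc, if_neg hc]
    simp

end BerezinKernel

/-! ### Convergence of the formal series -/

section Blocks

variable {k : ℕ} {n : Fin k → ℕ}
variable {E : Type*} [NormedAddCommGroup E] [InnerProductSpace ℂ E]

theorem tmap_mem_minTensor (T : E →L[ℂ] E) {f : Fock n →L[ℂ] Fock n} (hf : f ∈ polyballAlgebra n) :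
    tmap T f ∈ minTensor E n :=
  Submodule.le_topologicalClosure _ (Submodule.subset_span ⟨T, f, hf, rfl⟩)

variable [CompleteSpace E]

theorem coord_clm_sum_tmul (B : HTensor E (Fock n) →L[ℂ] HTensor E (Fock n)) (s : Finset (Words n))
    (x : Words n → E) (ω : Words n) :
    coord ω (B (∑ γ ∈ s, tmul (x γ) (basisVec γ))) = ∑ γ ∈ s, fourierCoeff B ω γ (x γ) := by
  simp only [map_sum, fourierCoeff_apply]

theorem opNorm_le_of_sum_tmul {B : HTensor E (Fock n) →L[ℂ] HTensor E (Fock n)} {C : ℝ}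
    (hC : 0 ≤ C) (h : ∀ (s : Finset (Words n)) (x : Words n → E),
      ‖B (∑ γ ∈ s, tmul (x γ) (basisVec γ))‖ ^ 2 ≤ C ^ 2 * ∑ γ ∈ s, ‖x γ‖ ^ 2) : ‖B‖ ≤ C := by
  refine B.opNorm_le_bound hC fun x => ?_
  have hx := hasSum_coord x
  refine le_of_tendsto_of_tendsto' ((B.continuous.norm.tendsto x).comp hx)
    ((continuous_const.mul continuous_norm).tendsto x |>.comp hx) fun s => ?_
  change ‖B (∑ γ ∈ s, tmul (coord γ x) (basisVec γ))‖
    ≤ C * ‖∑ γ ∈ s, tmul (coord γ x) (basisVec γ)‖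
  refine le_of_sq_le_sq ?_ (by positivity)
  rw [mul_pow, norm_sq_sum_tmul]
  exact h s _

theorem block_eq_smul (a : Words n → Words n → E →L[ℂ] E) (r : ℝ) (m : Fin k → ℤ) :
    block a r m = ((r : ℂ) ^ ∑ i, (m i).natAbs) • block a 1 m := by
  refine clm_ext_fourierCoeff fun ω γ => ?_
  have : fourierCoeff (((r : ℂ) ^ ∑ i, (m i).natAbs) • block a 1 m) ω γ
      = ((r : ℂ) ^ ∑ i, (m i).natAbs) • fourierCoeff (block a 1 m) ω γ := by
    ext1 h; simp [fourierCoeff_apply]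
  rw [this, fourierCoeff_block, fourierCoeff_block]
  split_ifs with h
  · rw [toep_eq_smul, h]
  · rw [smul_zero]

/-- The homogeneous parts of a bounded operator have smaller norm. -/
theorem norm_block_one_le {a : Words n → Words n → E →L[ℂ] E}
    {A : HTensor E (Fock n) →L[ℂ] HTensor E (Fock n)}
    (hA : ∀ ω γ, fourierCoeff A ω γ = toep a 1 ω γ) (m : Fin k → ℤ) : ‖block a 1 m‖ ≤ ‖A‖ := by
  classical
  refine opNorm_le_of_sum_tmul (norm_nonneg _) fun s x => norm_sq_le_of_sum_le fun t => ?_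
  -- The words are sorted by the lengths of their components. The block of degree `m` maps level `q
  -- + m` to level `q`; there it agrees with `A` applied to the part `y q` of the vector at level `q
  -- + m`. Different levels are orthogonal, so the estimates for the single levels add up.
  let lv : Words n → Fin k → ℤ := fun γ i => (γ i).length
  have hdeg : ∀ ω γ, deg ω γ = m ↔ lv γ - m = lv ω := fun ω γ => by
    have : deg ω γ = lv γ - lv ω := rfl
    rw [this]
    constructor <;> intro h
    · rw [← h, sub_sub_cancel]
    · rw [← h, sub_sub_cancel]
  let y : (Fin k → ℤ) → HTensor E (Fock n) := fun q =>
    ∑ γ ∈ s with lv γ - m = q, tmul (x γ) (basisVec γ)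
  have hcoord : ∀ ω, coord ω (block a 1 m (∑ γ ∈ s, tmul (x γ) (basisVec γ)))
      = coord ω (A (y (lv ω))) := fun ω => by
    rw [coord_clm_sum_tmul, coord_clm_sum_tmul, Finset.sum_filter]
    refine Finset.sum_congr rfl fun γ _ => ?_
    rw [fourierCoeff_block, hA]
    by_cases h : deg ω γ = m
    · rw [if_pos h, if_pos ((hdeg ω γ).1 h)]
    · rw [if_neg h, if_neg (mt (hdeg ω γ).2 h)]; rfl
  calc ∑ ω ∈ t, ‖coord ω (block a 1 m (∑ γ ∈ s, tmul (x γ) (basisVec γ)))‖ ^ 2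
      = ∑ ω ∈ t, ‖coord ω (A (y (lv ω)))‖ ^ 2 := by simp only [hcoord]
    _ = ∑ q ∈ t.image lv, ∑ ω ∈ t with lv ω = q, ‖coord ω (A (y (lv ω)))‖ ^ 2 :=
        (Finset.sum_fiberwise_of_maps_to (fun ω hω => Finset.mem_image_of_mem lv hω) _).symm
    _ ≤ ∑ q ∈ t.image lv, ‖A‖ ^ 2 * ∑ γ ∈ s with lv γ - m = q, ‖x γ‖ ^ 2 := by
        refine Finset.sum_le_sum fun q _ => ?_
        rw [← norm_sq_sum_tmul (s.filter _), ← mul_pow]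
        calc ∑ ω ∈ t with lv ω = q, ‖coord ω (A (y (lv ω)))‖ ^ 2
            = ∑ ω ∈ t with lv ω = q, ‖coord ω (A (y q))‖ ^ 2 :=
              Finset.sum_congr rfl fun ω hω => by rw [(Finset.mem_filter.1 hω).2]
          _ ≤ ‖A (y q)‖ ^ 2 := sum_norm_coord_sq_le _ _
          _ ≤ _ := by gcongr; exact A.le_opNorm _
    _ = ‖A‖ ^ 2 * ∑ γ ∈ s with lv γ - m ∈ t.image lv, ‖x γ‖ ^ 2 := by
        rw [← Finset.mul_sum, Finset.sum_fiberwise_eq_sum_filter]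
    _ ≤ ‖A‖ ^ 2 * ∑ γ ∈ s, ‖x γ‖ ^ 2 := by
        gcongr
        exact Finset.filter_subset _ _

theorem summable_block {a : Words n → Words n → E →L[ℂ] E}
    {A : HTensor E (Fock n) →L[ℂ] HTensor E (Fock n)}
    (hA : ∀ ω γ, fourierCoeff A ω γ = toep a 1 ω γ) {r : ℝ} (h0 : 0 ≤ r) (h1 : r < 1) :
    Summable (block a r) := by
  refine Summable.of_norm_bounded ((summable_pow_sum_natAbs h0 h1 k).mul_right ‖A‖) fun m => ?_
  rw [block_eq_smul, norm_smul, norm_pow, Complex.norm_real, Real.norm_of_nonneg h0]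
  gcongr
  exact norm_block_one_le hA m

/-- Each entry is fed by a single block, the one of degree `deg ω γ`. -/
theorem fourierCoeff_of_hasSum_block {a : Words n → Words n → E →L[ℂ] E} {r : ℝ}
    {T : HTensor E (Fock n) →L[ℂ] HTensor E (Fock n)} (hT : HasSum (block a r) T) (ω γ : Words n) :
    fourierCoeff T ω γ = toep a r ω γ := by
  classical
  ext1 h
  have h1 := (ContinuousLinearMap.apply ℂ _ (tmul h (basisVec γ))).hasSum hT
  have h2 := (coord (E := E) ω).hasSum h1
  refine h2.unique ?_
  have h3 := hasSum_ite_eq (deg ω γ) (toep a r ω γ h)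
  refine h3.congr_fun fun m => ?_
  rw [ContinuousLinearMap.apply_apply, ← fourierCoeff_apply, fourierCoeff_block]
  by_cases hm : deg ω γ = m
  · rw [if_pos hm, if_pos hm.symm]
  · rw [if_neg hm, if_neg (Ne.symm hm)]; rfl

theorem wordShift_mem_polyballAlgebra (α : Words n) : wordShift α ∈ polyballAlgebra n := by
  rw [← wordOp_leftCreation, wordOp]
  refine list_prod_mem fun T hT => ?_
  obtain ⟨i, rfl⟩ := (List.mem_ofFn' _ _).1 hT
  clear hT
  change FreeMonoid.lift (leftCreation i) (α i) ∈ polyballAlgebra n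
  induction α i using FreeMonoid.recOn with
  | one => rw [map_one]; exact one_mem _
  | of_mul j w ih =>
    rw [map_mul, FreeMonoid.lift_eval_of]
    exact mul_mem (Subalgebra.le_topologicalClosure _ (Algebra.subset_adjoin ⟨i, j, rfl⟩)) ih

/-- For an index `𝐒_α` and `𝐒_β^*` commute, so `T ⊗ 𝐒_α 𝐒_β^* = (I ⊗ 𝐒_β)^* (T ⊗ 𝐒_α)`. -/
theorem block_mem_starProductSpan (a : Words n → Words n → E →L[ℂ] E) (r : ℝ) (m : Fin k → ℤ) :
    block a r m ∈ starProductSpan E n := by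
  refine Submodule.sum_mem _ fun q hq => ?_
  have hq' : HasDegree m q.1 q.2 := by simpa using hq
  rw [tmap_smul_right, wordOp_leftCreation, wordOpStar_leftCreation]
  refine Submodule.smul_mem _ _ (Submodule.le_topologicalClosure _ (Submodule.subset_span
    ⟨_, tmap_mem_minTensor (.id ℂ E) (wordShift_mem_polyballAlgebra q.2), _,
      tmap_mem_minTensor (a q.1 q.2) (wordShift_mem_polyballAlgebra q.1), ?_⟩))
  rw [adjoint_tmap, tmap_comp, ContinuousLinearMap.adjoint_id, ContinuousLinearMap.id_comp]
  congr 1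
  exact (hasDegree_iff.1 hq').1.wordShift_comm

end Blocks

/-! ### Strong convergence -/

section Strong

variable {k : ℕ} {n : Fin k → ℕ}
variable {E : Type*} [NormedAddCommGroup E] [InnerProductSpace ℂ E] [CompleteSpace E]

theorem tendsto_apply_of_dense {ι X Y : Type*} [NormedAddCommGroup X] [NormedSpace ℂ X]
    [NormedAddCommGroup Y] [NormedSpace ℂ Y] {l : Filter ι} {T : ι → X →L[ℂ] Y} {A : X →L[ℂ] Y}
    {C : ℝ} (hT : ∀ᶠ i in l, ‖T i‖ ≤ C) {D : Set X} (hD : Dense D)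
    (h : ∀ x ∈ D, Filter.Tendsto (fun i => T i x) l (nhds (A x))) (x : X) :
    Filter.Tendsto (fun i => T i x) l (nhds (A x)) := by
  rw [Metric.tendsto_nhds]
  intro ε hε
  -- No sign of `C` is assumed, hence `|C|`; the summand `1` keeps the denominator positive.
  have hpos : 0 < |C| + ‖A‖ + 1 := by positivity
  obtain ⟨y, hy, hxy⟩ := Metric.mem_closure_iff.1 (hD x) (ε / 2 / (|C| + ‖A‖ + 1)) (by positivity)
  have hy' := Metric.tendsto_nhds.1 (h y hy) (ε / 2) (by positivity)
  filter_upwards [hT, hy'] with i hi hi'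
  rw [dist_eq_norm] at hxy hi' ⊢
  rw [lt_div_iff₀ hpos] at hxy
  have e : T i x - A x = T i (x - y) - A (x - y) + (T i y - A y) := by
    simp only [map_sub]; abel
  calc ‖T i x - A x‖ ≤ ‖T i (x - y)‖ + ‖A (x - y)‖ + ‖T i y - A y‖ := by
        rw [e]; exact (norm_add_le _ _).trans (by gcongr; exact norm_sub_le _ _)
    _ ≤ |C| * ‖x - y‖ + ‖A‖ * ‖x - y‖ + ‖T i y - A y‖ := by
        gcongr
        · exact (T i).le_of_opNorm_le (hi.trans (le_abs_self C)) _
        · exact A.le_opNorm _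
    _ < ε := by nlinarith [norm_nonneg (x - y)]

theorem Ico_mem_nhdsWithin_one : Set.Ico (0 : ℝ) 1 ∈ nhdsWithin 1 (Set.Iio 1) :=
  Ico_mem_nhdsLT zero_lt_one

/-- On `h ⊗ e_γ` the squared distance is the sum of `|r ^ d - 1| ^ 2 * ‖toep a 1 ω γ h‖ ^ 2` over
`ω`, with `d` the absolute degree. It is dominated by the square summable column of `A`, and each
term tends to `0`. -/
theorem tendsto_of_fourierCoeff {a : Words n → Words n → E →L[ℂ] E}
    {A : HTensor E (Fock n) →L[ℂ] HTensor E (Fock n)}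
    {Φ : ℝ → HTensor E (Fock n) →L[ℂ] HTensor E (Fock n)}
    (hA : ∀ ω γ, fourierCoeff A ω γ = toep a 1 ω γ)
    (hΦ : ∀ r ∈ Set.Ico (0 : ℝ) 1, ∀ ω γ, fourierCoeff (Φ r) ω γ = toep a r ω γ)
    (hle : ∀ r ∈ Set.Ico (0 : ℝ) 1, ‖Φ r‖ ≤ ‖A‖) (x : HTensor E (Fock n)) :
    Filter.Tendsto (fun r => Φ r x) (nhdsWithin 1 (Set.Iio 1)) (nhds (A x)) := by
  have hev : ∀ᶠ r in nhdsWithin (1 : ℝ) (Set.Iio 1), r ∈ Set.Ico (0 : ℝ) 1 :=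
    Ico_mem_nhdsWithin_one
  refine tendsto_apply_of_dense (hev.mono hle) dense_polynomials (fun p hp => ?_) x
  induction hp using Submodule.span_induction with
  | zero => simp
  | add p q _ _ hp hq => simpa using hp.add hq
  | smul c p _ hp => simpa using hp.const_smul c
  | mem p hp =>
    obtain ⟨h, γ, rfl⟩ := hp
    rw [tendsto_iff_norm_sub_tendsto_zero]
    have hcoord : ∀ r ∈ Set.Ico (0 : ℝ) 1, ∀ ω,
        ‖coord ω (Φ r (tmul h (basisVec γ)) - A (tmul h (basisVec γ)))‖ ^ 2
        = |r ^ (∑ i, (deg ω γ i).natAbs) - 1| ^ 2 * ‖toep a 1 ω γ h‖ ^ 2 := by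
      intro r hr ω
      rw [map_sub, ← fourierCoeff_apply, ← fourierCoeff_apply, hA, hΦ r hr, toep_eq_smul a r,
        smul_apply]
      nth_rewrite 2 [← one_smul ℂ (toep a 1 ω γ h)]
      rw [← sub_smul, norm_smul, mul_pow, ← Complex.ofReal_pow, ← Complex.ofReal_one,
        ← Complex.ofReal_sub, Complex.norm_real, Real.norm_eq_abs]
    have hbound : Summable fun ω => ‖toep a 1 ω γ h‖ ^ 2 := by
      have := (hasSum_norm_coord_sq (A (tmul h (basisVec γ)))).summable
      simpa only [← fourierCoeff_apply, hA] using this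
    have hlim : Filter.Tendsto (fun r : ℝ => ∑' ω : Words n,
        |r ^ (∑ i, (deg ω γ i).natAbs) - 1| ^ 2 * ‖toep a 1 ω γ h‖ ^ 2)
        (nhdsWithin 1 (Set.Iio 1)) (nhds (∑' _ : Words n, (0 : ℝ))) := by
      refine tendsto_tsum_of_dominated_convergence hbound (fun ω => ?_) (hev.mono fun r hr ω => ?_)
      · have hc : Continuous fun r : ℝ =>
          |r ^ (∑ i, (deg ω γ i).natAbs) - 1| ^ 2 * ‖toep a 1 ω γ h‖ ^ 2 := by fun_prop
        simpa using (hc.tendsto 1).mono_left nhdsWithin_le_nhds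
      · have hp0 : 0 ≤ r ^ (∑ i, (deg ω γ i).natAbs) := pow_nonneg hr.1 _
        have hp1 : r ^ (∑ i, (deg ω γ i).natAbs) ≤ 1 := pow_le_one₀ hr.1 hr.2.le
        rw [Real.norm_of_nonneg (by positivity)]
        refine mul_le_of_le_one_left (by positivity) ?_
        refine pow_le_one₀ (abs_nonneg _) ?_
        rw [abs_le]
        constructor <;> linarith
    rw [tsum_zero] at hlim
    have hsq : Filter.Tendsto
        (fun r => ‖Φ r (tmul h (basisVec γ)) - A (tmul h (basisVec γ))‖ ^ 2)
        (nhdsWithin 1 (Set.Iio 1)) (nhds 0) := by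
      refine hlim.congr' (hev.mono fun r hr => ?_)
      simp only [← hcoord r hr]
      exact (hasSum_norm_coord_sq _).tsum_eq
    simpa [Real.sqrt_sq] using hsq.sqrt

theorem isLUB_norm_of_tendsto {X : Type*} [NormedAddCommGroup X] [NormedSpace ℂ X]
    {Φ : ℝ → X →L[ℂ] X} {A : X →L[ℂ] X} (hle : ∀ r ∈ Set.Ico (0 : ℝ) 1, ‖Φ r‖ ≤ ‖A‖)
    (h : ∀ x, Filter.Tendsto (fun r => Φ r x) (nhdsWithin 1 (Set.Iio 1)) (nhds (A x))) :
    IsLUB ((fun r => ‖Φ r‖) '' Set.Ico (0 : ℝ) 1) ‖A‖ := by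
  constructor
  · rintro _ ⟨r, hr, rfl⟩
    exact hle r hr
  · intro c hc
    have hc' : ∀ r ∈ Set.Ico (0 : ℝ) 1, ‖Φ r‖ ≤ c := fun r hr => hc ⟨r, hr, rfl⟩
    refine A.opNorm_le_bound ((norm_nonneg _).trans (hc' 0 ⟨le_rfl, zero_lt_one⟩)) fun x => ?_
    refine le_of_tendsto (h x).norm (Filter.mem_of_superset Ico_mem_nhdsWithin_one fun r hr => ?_)
    exact (Φ r).le_of_opNorm_le (hc' r hr) x

/-- The norm is lower semicontinuous under strong convergence: a vector with `c * ‖x‖ < ‖A x‖` shows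
`c < ‖Φ r‖` for `r` near `1`. The upper estimate is `hle`. -/
theorem tendsto_norm_of_tendsto {X : Type*} [NormedAddCommGroup X] [NormedSpace ℂ X]
    {Φ : ℝ → X →L[ℂ] X} {A : X →L[ℂ] X} (hle : ∀ r ∈ Set.Ico (0 : ℝ) 1, ‖Φ r‖ ≤ ‖A‖)
    (h : ∀ x, Filter.Tendsto (fun r => Φ r x) (nhdsWithin 1 (Set.Iio 1)) (nhds (A x))) :
    Filter.Tendsto (fun r => ‖Φ r‖) (nhdsWithin 1 (Set.Iio 1)) (nhds ‖A‖) := by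
  rw [tendsto_order]
  constructor
  · intro c hc
    rcases lt_or_ge c 0 with hc0 | hc0
    · exact Filter.Eventually.of_forall fun r => hc0.trans_le (norm_nonneg _)
    · obtain ⟨x, hx⟩ : ∃ x, c * ‖x‖ < ‖A x‖ := by
        by_contra! hcon
        exact hc.not_ge (A.opNorm_le_bound hc0 hcon)
      filter_upwards [(h x).norm.eventually_const_lt hx] with r hr
      exact lt_of_mul_lt_mul_right (hr.trans_le ((Φ r).le_opNorm x)) (norm_nonneg x)
  · intro c hc
    exact Filter.mem_of_superset Ico_mem_nhdsWithin_one fun r hr => (hle r hr).trans_lt hc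

end Strong

/-! ### The action of the formal series on polynomials -/

section Columns

variable {k : ℕ} {n : Fin k → ℕ}
variable {E : Type*} [NormedAddCommGroup E] [InnerProductSpace ℂ E]

theorem norm_toep_apply_le (a : Words n → Words n → E →L[ℂ] E) {r : ℝ} (hr : r ∈ Set.Icc (0 : ℝ) 1)
    (ω γ : Words n) (h : E) : ‖toep a r ω γ h‖ ≤ ‖toep a 1 ω γ h‖ := by
  rw [toep_eq_smul, smul_apply, norm_smul, norm_pow, Complex.norm_real, Real.norm_of_nonneg hr.1]
  exact mul_le_of_le_one_left (norm_nonneg _) (pow_le_one₀ hr.1 hr.2)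

variable [CompleteSpace E]

/-- The blocks split the column `γ` of `toep a r` according to the degree of the row, so their sum
is a regrouping of the orthogonal expansion of `v`. -/
theorem hasSum_block_tmul {a : Words n → Words n → E →L[ℂ] E} {r : ℝ} {γ : Words n} {h : E}
    {v : HTensor E (Fock n)} (hv : ∀ ω, coord ω v = toep a r ω γ h) :
    HasSum (fun m => block a r m (tmul h (basisVec γ))) v := by
  classical
  refine hasSum_of_coord_fiber (fun ω => deg ω γ) v _ (fun ω => ?_) fun m ω hm => ?_
  · rw [← fourierCoeff_apply, fourierCoeff_block, if_pos rfl, hv]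
  · rw [← fourierCoeff_apply, fourierCoeff_block, if_neg hm]; rfl

theorem hasSum_block_one_apply {a : Words n → Words n → E →L[ℂ] E}
    {A : HTensor E (Fock n) →L[ℂ] HTensor E (Fock n)}
    (hA : ∀ ω γ, fourierCoeff A ω γ = toep a 1 ω γ) {q : HTensor E (Fock n)}
    (hq : q ∈ polynomials E n) : HasSum (fun m => block a 1 m q) (A q) := by
  induction hq using Submodule.span_induction with
  | zero => simp
  | add p q _ _ hp hq => simpa using hp.add hq
  | smul c p _ hp => simpa using hp.const_smul c
  | mem p hp =>
    obtain ⟨h, γ, rfl⟩ := hp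
    exact hasSum_block_tmul fun ω => by rw [← fourierCoeff_apply, hA]

theorem exists_hasSum_block_apply {a : Words n → Words n → E →L[ℂ] E} {r : ℝ}
    (hs : ∀ γ h, Summable fun ω => ‖toep a r ω γ h‖ ^ 2) {q : HTensor E (Fock n)}
    (hq : q ∈ polynomials E n) : ∃ v, HasSum (fun m => block a r m q) v := by
  induction hq using Submodule.span_induction with
  | zero => exact ⟨0, by simp⟩
  | add p q _ _ hp hq =>
    obtain ⟨v, hv⟩ := hp
    obtain ⟨w, hw⟩ := hq
    exact ⟨v + w, by simpa using hv.add hw⟩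
  | smul c p _ hp =>
    obtain ⟨v, hv⟩ := hp
    exact ⟨c • v, by simpa using hv.const_smul c⟩
  | mem p hp =>
    obtain ⟨h, γ, rfl⟩ := hp
    obtain ⟨v, hv⟩ := exists_coord_eq (hs γ h)
    exact ⟨v, hasSum_block_tmul hv⟩

/-- With `C h = A (h ⊗ e_γ)`, the terms are `C_ω^* C_ω` for the coordinates `C_ω` of `C`, and
Parseval gives the weak sum `C^* C`. Rows not comparable with `γ` vanish. -/
theorem columnsWOTSummable_of_fourierCoeff {a : Words n → Words n → E →L[ℂ] E}
    {A : HTensor E (Fock n) →L[ℂ] HTensor E (Fock n)}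
    (hA : ∀ ω γ, fourierCoeff A ω γ = toep a 1 ω γ) : ColumnsWOTSummable a := by
  intro γ
  let C := A ∘L tmulRight E (basisVec γ)
  have hC : ∀ ω x, coord ω (C x) = toep a 1 ω γ x := fun ω x => by
    rw [← hA, fourierCoeff_apply]; rfl
  refine ⟨ContinuousLinearMapWOT.ofCLM (ContinuousLinearMap.adjoint C ∘L C), ?_⟩
  refine ContinuousLinearMapWOT.tendsto_iff_forall_inner_apply_tendsto.2 fun x y => ?_
  have h1 : HasSum (fun ω : Words n => ⟪toep a 1 ω γ y, toep a 1 ω γ x⟫_ℂ) ⟪C y, C x⟫_ℂ := by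
    have := (innerSL ℂ (C y)).hasSum (hasSum_coord (C x))
    refine this.congr_fun fun ω => ?_
    rw [innerSL_apply_apply, ← inner_conj_symm (C y), ← inner_coord, inner_conj_symm, hC, hC]
  rw [← hasSum_subtype_iff_of_support_subset (s := {ω | RightComparable ω γ})] at h1
  · have h2 : ⟪y, (ContinuousLinearMap.adjoint C ∘L C) x⟫_ℂ = ⟪C y, C x⟫_ℂ := by
      rw [ContinuousLinearMap.comp_apply, ContinuousLinearMap.adjoint_inner_right]
    rw [ContinuousLinearMapWOT.ofCLM_apply, h2]
    refine Filter.Tendsto.congr (fun s => ?_) h1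
    have h3 : ∀ (s : Finset {ω : Words n // RightComparable ω γ})
        (f : {ω : Words n // RightComparable ω γ} → E →WOT[ℂ] E),
        ⟪y, (∑ ω ∈ s, f ω) x⟫_ℂ = ∑ ω ∈ s, ⟪y, f ω x⟫_ℂ := by
      classical
      intro s f
      induction s using Finset.induction_on with
      | empty => simp
      | insert ω s hω ih =>
        rw [Finset.sum_insert hω, Finset.sum_insert hω, ContinuousLinearMapWOT.add_apply,
          inner_add_right, ih]
    rw [h3]
    refine Finset.sum_congr rfl fun ω _ => ?_
    rw [ContinuousLinearMapWOT.ofCLM_apply, ContinuousLinearMap.comp_apply,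
      ContinuousLinearMap.adjoint_inner_right, Function.comp_apply, toep_one a ω.2]
    rfl
  · intro ω hω
    by_contra hne
    refine hω ?_
    simp only [toep, if_neg (show ¬ RightComparable ω γ from hne), zero_apply, inner_zero_left]

/-- Weak convergence tested on the pair `(h, h)` is square summability of the column at `r = 1`,
which dominates the columns for smaller `r`. -/
theorem ColumnsWOTSummable.summable_norm_sq {a : Words n → Words n → E →L[ℂ] E}
    (ha : ColumnsWOTSummable a) {r : ℝ} (hr : r ∈ Set.Icc (0 : ℝ) 1) (γ : Words n) (h : E) :
    Summable fun ω => ‖toep a r ω γ h‖ ^ 2 := by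
  refine Summable.of_nonneg_of_le (fun _ => by positivity)
    (fun ω => pow_le_pow_left₀ (norm_nonneg _) (norm_toep_apply_le a hr ω γ h) 2) ?_
  let φ : (E →WOT[ℂ] E) →+ ℂ :=
    { toFun := fun T => ⟪h, T h⟫_ℂ
      map_zero' := by simp
      map_add' := fun S T => by rw [ContinuousLinearMapWOT.add_apply, inner_add_right] }
  have hφ : Continuous φ := ContinuousLinearMapWOT.continuous_dual_apply h (innerSL ℂ h)
  have h1 := (ha γ).map φ hφ
  have h2 : Summable fun ω : {ω : Words n // RightComparable ω γ} => ‖toep a 1 ω.1 γ h‖ ^ 2 := by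
    rw [← Complex.summable_ofReal]
    refine h1.congr fun ω => ?_
    rw [Function.comp_apply, toep_one a ω.2]
    simp only [φ, AddMonoidHom.coe_mk, ZeroHom.coe_mk, ContinuousLinearMapWOT.ofCLM_apply,
      ContinuousLinearMap.comp_apply, ContinuousLinearMap.adjoint_inner_right,
      inner_self_eq_norm_sq_to_K]
    push_cast
    rfl
  refine ((hasSum_subtype_iff_of_support_subset
    (f := fun ω => ‖toep a 1 ω γ h‖ ^ 2) (s := {ω | RightComparable ω γ}) ?_).1 h2.hasSum).summable
  intro ω hω
  by_contra hne
  refine hω ?_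
  simp only [toep, if_neg (show ¬ RightComparable ω γ from hne), zero_apply]
  simp

/-- For `r < 1` the hypothesis bounds every finite section of `toep a r` by `M`. Finite sections are
continuous in `r`, so the bound holds at `r = 1`, where `exists_clm_of_matrix` applies. -/
theorem exists_of_polynomial_bound {a : Words n → Words n → E →L[ℂ] E} {M : ℝ}
    (hM : ∀ r ∈ Set.Ico (0 : ℝ) 1, ∀ p ∈ polynomials E n, ‖p‖ ≤ 1 →
      ∃ v, HasIterSum (fun m => block a r m p) v ∧ ‖v‖ ≤ M) :
    ∃ A : HTensor E (Fock n) →L[ℂ] HTensor E (Fock n),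
      ∀ ω γ, fourierCoeff A ω γ = toep a 1 ω γ := by
  classical
  have hM0 : 0 ≤ M := by
    obtain ⟨v, -, hv⟩ := hM 0 ⟨le_rfl, zero_lt_one⟩ 0 (Submodule.zero_mem _) (by simp)
    exact (norm_nonneg v).trans hv
  have hscaled : ∀ r ∈ Set.Ico (0 : ℝ) 1, ∀ p ∈ polynomials E n,
      ∃ v, HasIterSum (fun m => block a r m p) v ∧ ‖v‖ ≤ M * ‖p‖ := by
    intro r hr p hp
    -- Normalization of `p`. For `p = 0` the factor `‖p‖⁻¹` is `0`, and the argument still goes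
    -- through.
    obtain ⟨v, hv, hvM⟩ := hM r hr (((‖p‖⁻¹ : ℝ) : ℂ) • p) (Submodule.smul_mem _ _ hp) (by
      rw [norm_smul, Complex.norm_real, norm_inv, norm_norm]
      exact inv_mul_le_one)
    refine ⟨(‖p‖ : ℂ) • v, ?_, ?_⟩
    · have := hv.map (smulAddHom ℂ (HTensor E (Fock n)) (‖p‖ : ℂ))
        (continuous_const_smul (‖p‖ : ℂ))
      refine (congrArg (HasIterSum · ((‖p‖ : ℂ) • v)) (funext fun m => ?_)).mp this
      rw [smulAddHom_apply, map_smul, smul_smul, ← Complex.ofReal_mul]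
      by_cases h0 : ‖p‖ = 0
      · rw [norm_eq_zero] at h0
        simp [h0]
      · rw [mul_inv_cancel₀ h0, Complex.ofReal_one, one_smul]
    · rw [norm_smul, Complex.norm_real, norm_norm, mul_comm]
      gcongr
  refine exists_clm_of_matrix (toep a 1) hM0 fun s t x => ?_
  have hr : ∀ r ∈ Set.Ico (0 : ℝ) 1,
      ∑ ω ∈ t, ‖∑ γ ∈ s, toep a r ω γ (x γ)‖ ^ 2 ≤ M ^ 2 * ∑ γ ∈ s, ‖x γ‖ ^ 2 := by
    intro r hr
    obtain ⟨v, hv, hvM⟩ := hscaled r hr (∑ γ ∈ s, tmul (x γ) (basisVec γ))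
      (Submodule.sum_mem _ fun γ _ => mem_polynomials_tmul _ _)
    have hcoord : ∀ ω, coord ω v = ∑ γ ∈ s, toep a r ω γ (x γ) := fun ω => by
      have h1 := hv.map (coord (E := E) ω).toLinearMap.toAddMonoidHom (coord ω).continuous
      refine h1.unique (HasIterSum.of_hasSum ?_)
      -- Each `γ ∈ s` contributes to the coordinate `ω` in one degree only, so the series of
      -- coordinates has finitely many nonzero terms; uniqueness of iterated sums then identifies
      -- `coord ω v`.
      have h2 := hasSum_sum fun γ (_ : γ ∈ s) => hasSum_ite_eq (deg ω γ) (toep a r ω γ (x γ))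
      refine h2.congr_fun fun m => ?_
      refine (coord_clm_sum_tmul (block a r m) s x ω).trans (Finset.sum_congr rfl fun γ _ => ?_)
      rw [fourierCoeff_block]
      by_cases hm : deg ω γ = m
      · rw [if_pos hm, if_pos hm.symm]
      · rw [if_neg hm, if_neg (Ne.symm hm)]; rfl
    calc _ = ∑ ω ∈ t, ‖coord ω v‖ ^ 2 := by simp only [hcoord]
      _ ≤ ‖v‖ ^ 2 := sum_norm_coord_sq_le v t
      _ ≤ (M * ‖∑ γ ∈ s, tmul (x γ) (basisVec γ)‖) ^ 2 := by gcongr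
      _ = _ := by rw [mul_pow, norm_sq_sum_tmul]
  have hcont : Continuous fun r : ℝ => ∑ ω ∈ t, ‖∑ γ ∈ s, toep a r ω γ (x γ)‖ ^ 2 := by
    have : ∀ ω γ, Continuous fun r : ℝ => toep a r ω γ (x γ) := fun ω γ => by
      have h (r : ℝ) := congrArg (fun T : E →L[ℂ] E => T (x γ)) (toep_eq_smul a r ω γ)
      simp only [smul_apply] at h
      rw [funext h]
      fun_prop
    fun_prop
  exact le_of_tendsto ((hcont.tendsto 1).mono_left nhdsWithin_le_nhds)
    (Filter.mem_of_superset Ico_mem_nhdsWithin_one hr)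

theorem opNorm_le_of_polynomials {A : HTensor E (Fock n) →L[ℂ] HTensor E (Fock n)} {c : ℝ}
    (h : ∀ q ∈ polynomials E n, ‖q‖ ≤ 1 → ‖A q‖ ≤ c) : ‖A‖ ≤ c := by
  have hc : 0 ≤ c := by simpa using h 0 (Submodule.zero_mem _) (by simp)
  refine A.opNorm_le_bound hc fun x => ?_
  refine (isClosed_le (f := fun x => ‖A x‖) (g := fun x => c * ‖x‖) (by fun_prop)
    (by fun_prop)).closure_subset_iff.2 (fun q hq => ?_) (dense_polynomials x)
  have h1 := h (((‖q‖⁻¹ : ℝ) : ℂ) • q) (Submodule.smul_mem _ _ hq) (by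
    rw [norm_smul, Complex.norm_real, norm_inv, norm_norm]
    exact inv_mul_le_one)
  rw [map_smul, norm_smul, Complex.norm_real, norm_inv, norm_norm] at h1
  rcases eq_or_ne q 0 with rfl | h0
  · simp
  · exact (inv_mul_le_iff₀' (norm_pos_iff.2 h0)).1 h1

end Columns

/-! ### Radial sums of a multi-Toeplitz operator and the equivalences -/

section Main

variable {k : ℕ} {n : Fin k → ℕ}
variable {E : Type*} [NormedAddCommGroup E] [InnerProductSpace ℂ E]

theorem HasIterSum.apply {F : (Fin k → ℤ) → HTensor E (Fock n) →L[ℂ] HTensor E (Fock n)}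
    {T : HTensor E (Fock n) →L[ℂ] HTensor E (Fock n)} (h : HasIterSum F T)
    (p : HTensor E (Fock n)) : HasIterSum (fun m => F m p) (T p) :=
  h.map (ContinuousLinearMap.apply ℂ _ p).toLinearMap.toAddMonoidHom
    (ContinuousLinearMap.apply ℂ _ p).continuous

variable [CompleteSpace E]

/-- The sums `φ(r𝐒)` of the Fourier series of a multi-Toeplitz operator `A` are Berezin transforms
of `A`, and they converge strongly to `A`. -/
theorem exists_radial_sums {a : Words n → Words n → E →L[ℂ] E}
    {A : HTensor E (Fock n) →L[ℂ] HTensor E (Fock n)} (hA : IsMultiToeplitz A)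
    (ha : IsFourierSeries a A) :
    ∃ Φ : ℝ → HTensor E (Fock n) →L[ℂ] HTensor E (Fock n),
      (∀ r ∈ Set.Ico (0 : ℝ) 1, HasSum (block a r) (Φ r) ∧ ‖Φ r‖ ≤ ‖A‖ ∧
        ∃ K : Fock n →L[ℂ] HTensor (Fock n) (Fock n),
          IsBerezinKernel (scaledShift n r) K ∧ Φ r = berezinExt K A) ∧
      ∀ x, Filter.Tendsto (fun r => Φ r x) (nhdsWithin 1 (Set.Iio 1)) (nhds (A x)) := by
  have hent := isMultiToeplitz_and_isFourierSeries_iff.1 ⟨hA, ha⟩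
  have key : ∀ r ∈ Set.Ico (0 : ℝ) 1, HasSum (block a r) (∑' m, block a r m) ∧
      ‖∑' m, block a r m‖ ≤ ‖A‖ ∧ ∃ K : Fock n →L[ℂ] HTensor (Fock n) (Fock n),
        IsBerezinKernel (scaledShift n r) K ∧ ∑' m, block a r m = berezinExt K A := by
    intro r hr
    have hsum := (summable_block hent hr.1 hr.2).hasSum
    obtain ⟨K, hK⟩ := exists_isometry_berezinVec (n := n) hr.1 hr.2
    have heq : ∑' m, block a r m = berezinExt K.toContinuousLinearMap A :=
      clm_ext_fourierCoeff fun ω γ => by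
        rw [fourierCoeff_of_hasSum_block hsum, fourierCoeff_berezinExt hr.1 hr.2 hK hA ha]
    exact ⟨hsum, heq ▸ norm_berezinExt_le K A, K.toContinuousLinearMap,
      isBerezinKernel_of_basisVec hr.1 hr.2 hK, heq⟩
  exact ⟨fun r => ∑' m, block a r m, key, tendsto_of_fourierCoeff hent
    (fun r hr => fourierCoeff_of_hasSum_block (key r hr).1) fun r hr => (key r hr).2.1⟩

/-- The pivot of both characterizations: a bound on operator norms yields a bound on polynomials,
from which the operator is constructed. -/
theorem exists_isMultiToeplitz_iff_polynomial_bound (a : Words n → Words n → E →L[ℂ] E) :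
    (∃ A, IsMultiToeplitz A ∧ IsFourierSeries a A) ↔
      ∃ M : ℝ, ∀ r ∈ Set.Ico (0 : ℝ) 1, ∀ p ∈ polynomials E n, ‖p‖ ≤ 1 →
        ∃ v, HasIterSum (fun m => block a r m p) v ∧ ‖v‖ ≤ M := by
  constructor
  · rintro ⟨A, hA, ha⟩
    obtain ⟨Φ, hΦ, -⟩ := exists_radial_sums hA ha
    refine ⟨‖A‖, fun r hr p _ hp1 => ⟨Φ r p, (HasIterSum.of_hasSum (hΦ r hr).1).apply p, ?_⟩⟩
    refine ((Φ r).le_of_opNorm_le (hΦ r hr).2.1 p).trans ?_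
    exact mul_le_of_le_one_right (norm_nonneg _) hp1
  · rintro ⟨M, hM⟩
    obtain ⟨A, hA⟩ := exists_of_polynomial_bound hM
    exact ⟨A, isMultiToeplitz_and_isFourierSeries_iff.2 hA⟩

theorem exists_isMultiToeplitz_iff_norm_bound (a : Words n → Words n → E →L[ℂ] E) :
    (∃ A, IsMultiToeplitz A ∧ IsFourierSeries a A) ↔
      ∃ Φ : ℝ → (HTensor E (Fock n) →L[ℂ] HTensor E (Fock n)),
        (∀ r ∈ Set.Ico (0 : ℝ) 1, HasIterSum (block a r) (Φ r)) ∧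
        BddAbove ((fun r => ‖Φ r‖) '' Set.Ico (0 : ℝ) 1) := by
  constructor
  · rintro ⟨A, hA, ha⟩
    obtain ⟨Φ, hΦ, -⟩ := exists_radial_sums hA ha
    refine ⟨Φ, fun r hr => HasIterSum.of_hasSum (hΦ r hr).1, ‖A‖, ?_⟩
    rintro _ ⟨r, hr, rfl⟩
    exact (hΦ r hr).2.1
  · rintro ⟨Φ, hΦ, M, hM⟩
    refine (exists_isMultiToeplitz_iff_polynomial_bound a).2 ⟨M, fun r hr p _ hp1 =>
      ⟨Φ r p, (hΦ r hr).apply p, ?_⟩⟩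
    have hle : ‖Φ r‖ ≤ M := hM ⟨r, hr, rfl⟩
    exact ((Φ r).le_of_opNorm_le hle p).trans
      (mul_le_of_le_one_right ((norm_nonneg _).trans hle) hp1)

theorem isLUB_norm_polynomials {a : Words n → Words n → E →L[ℂ] E}
    {A : HTensor E (Fock n) →L[ℂ] HTensor E (Fock n)}
    (h : ∀ q ∈ polynomials E n, HasIterSum (fun m => block a 1 m q) (A q)) :
    IsLUB {c : ℝ | ∃ q ∈ polynomials E n, ‖q‖ ≤ 1 ∧
      ∃ v, HasIterSum (fun m => block a 1 m q) v ∧ c = ‖v‖} ‖A‖ := by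
  constructor
  · rintro _ ⟨q, hq, hq1, v, hv, rfl⟩
    rw [hv.unique (h q hq)]
    exact (A.le_opNorm q).trans (mul_le_of_le_one_right (norm_nonneg _) hq1)
  · intro c hc
    exact opNorm_le_of_polynomials fun q hq hq1 => hc ⟨q, hq, hq1, A q, h q hq, rfl⟩

end Main

end Polyball

end

theorem mainTheorem2 {k : ℕ} (hk : 1 ≤ k) (n : Fin k → ℕ) (hn : ∀ i, 1 ≤ n i)
    {E : Type*} [NormedAddCommGroup E] [InnerProductSpace ℂ E] [CompleteSpace E] :
    -- characterizations of the formal series that are Fourier series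
    (∀ a : Polyball.Words n → Polyball.Words n → E →L[ℂ] E,
      ((∃ A, Polyball.IsMultiToeplitz A ∧ Polyball.IsFourierSeries a A) ↔
        ∃ Φ : ℝ → (Polyball.HTensor E (Polyball.Fock n) →L[ℂ] Polyball.HTensor E (Polyball.Fock n)),
          (∀ r ∈ Set.Ico (0 : ℝ) 1, Polyball.HasIterSum (Polyball.block a r) (Φ r)) ∧
          BddAbove ((fun r => ‖Φ r‖) '' Set.Ico (0 : ℝ) 1)) ∧
      (Polyball.ColumnsWOTSummable a →
        ∀ r ∈ Set.Icc (0 : ℝ) 1, ∀ p ∈ Polyball.polynomials E n,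
          ∃ v, Polyball.HasIterSum (fun m => Polyball.block a r m p) v) ∧
      ((∃ A, Polyball.IsMultiToeplitz A ∧ Polyball.IsFourierSeries a A) ↔
        Polyball.ColumnsWOTSummable a ∧
        ∃ M : ℝ, ∀ r ∈ Set.Ico (0 : ℝ) 1, ∀ p ∈ Polyball.polynomials E n, ‖p‖ ≤ 1 →
          ∃ v, Polyball.HasIterSum (fun m => Polyball.block a r m p) v ∧ ‖v‖ ≤ M)) ∧
    -- properties of a multi-Toeplitz operator and its Fourier series
    (∀ (a : Polyball.Words n → Polyball.Words n → E →L[ℂ] E)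
      (A : Polyball.HTensor E (Polyball.Fock n) →L[ℂ] Polyball.HTensor E (Polyball.Fock n)),
      Polyball.IsMultiToeplitz A → Polyball.IsFourierSeries a A →
      (∃ Φ : ℝ → (Polyball.HTensor E (Polyball.Fock n) →L[ℂ] Polyball.HTensor E (Polyball.Fock n)),
        (∀ r ∈ Set.Ico (0 : ℝ) 1,
          Polyball.HasIterSum (Polyball.block a r) (Φ r) ∧
          HasSum (Polyball.block a r) (Φ r) ∧
          Φ r ∈ Polyball.starProductSpan E n ∧
          ∃ K : Polyball.Fock n →L[ℂ] Polyball.HTensor (Polyball.Fock n) (Polyball.Fock n),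
            Polyball.IsBerezinKernel (Polyball.scaledShift n r) K ∧
            Φ r = Polyball.berezinExt K A) ∧
        (∀ x, Filter.Tendsto (fun r => Φ r x) (nhdsWithin 1 (Set.Iio 1)) (nhds (A x))) ∧
        IsLUB ((fun r => ‖Φ r‖) '' Set.Ico (0 : ℝ) 1) ‖A‖ ∧
        Filter.Tendsto (fun r => ‖Φ r‖) (nhdsWithin 1 (Set.Iio 1)) (nhds ‖A‖)) ∧
      (∀ q ∈ Polyball.polynomials E n,
        Polyball.HasIterSum (fun m => Polyball.block a 1 m q) (A q)) ∧
      IsLUB {c : ℝ | ∃ q ∈ Polyball.polynomials E n, ‖q‖ ≤ 1 ∧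
        ∃ v, Polyball.HasIterSum (fun m => Polyball.block a 1 m q) v ∧ c = ‖v‖} ‖A‖) ∧
    -- uniqueness
    (∀ A B : Polyball.HTensor E (Polyball.Fock n) →L[ℂ] Polyball.HTensor E (Polyball.Fock n),
      Polyball.IsMultiToeplitz A → Polyball.IsMultiToeplitz B →
      (A = B ↔ ∀ α β : Polyball.Words n, Polyball.IsIndex α β →
        Polyball.fourierCoeff A α β = Polyball.fourierCoeff B α β)) := by
  refine ⟨fun a => ⟨Polyball.exists_isMultiToeplitz_iff_norm_bound a, fun hc r hr p hp => ?_,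
    fun h => ⟨?_, (Polyball.exists_isMultiToeplitz_iff_polynomial_bound a).1 h⟩,
    fun h => (Polyball.exists_isMultiToeplitz_iff_polynomial_bound a).2 h.2⟩,
    fun a A hA ha => ?_, fun A B hA hB => ⟨fun h α β _ => by rw [h], fun h => ?_⟩⟩
  · obtain ⟨v, hv⟩ := Polyball.exists_hasSum_block_apply (hc.summable_norm_sq hr) hp
    exact ⟨v, .of_hasSum hv⟩
  · obtain ⟨A, hA⟩ := h
    exact Polyball.columnsWOTSummable_of_fourierCoeff
      (Polyball.isMultiToeplitz_and_isFourierSeries_iff.1 hA)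
  · have hent := Polyball.isMultiToeplitz_and_isFourierSeries_iff.1 ⟨hA, ha⟩
    obtain ⟨Φ, hΦ, hlim⟩ := Polyball.exists_radial_sums hA ha
    have hpoly : ∀ q ∈ Polyball.polynomials E n,
        Polyball.HasIterSum (fun m => Polyball.block a 1 m q) (A q) := fun q hq =>
      .of_hasSum (Polyball.hasSum_block_one_apply hent hq)
    have hle : ∀ r ∈ Set.Ico (0 : ℝ) 1, ‖Φ r‖ ≤ ‖A‖ := fun r hr => (hΦ r hr).2.1
    refine ⟨⟨Φ, fun r hr => ⟨.of_hasSum (hΦ r hr).1, (hΦ r hr).1, ?_, (hΦ r hr).2.2⟩, hlim,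
      Polyball.isLUB_norm_of_tendsto hle hlim, Polyball.tendsto_norm_of_tendsto hle hlim⟩, hpoly,
      Polyball.isLUB_norm_polynomials hpoly⟩
    -- The finite partial sums lie in the span of products, and its closure contains their norm
    -- limit.
    exact (Submodule.isClosed_topologicalClosure _).mem_of_tendsto (hΦ r hr).1
      (Filter.Eventually.of_forall fun s => Submodule.sum_mem _ fun m _ =>
        Polyball.block_mem_starProductSpan a r m)
  -- With the coefficients of `A` as the family `a`, both operators have the matrix `toep a 1`.
  · have hA' := Polyball.isMultiToeplitz_and_isFourierSeries_iff.1 ⟨hA, fun _ _ _ => rfl⟩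
    have hB' := Polyball.isMultiToeplitz_and_isFourierSeries_iff.1 ⟨hB, h⟩
    exact Polyball.clm_ext_fourierCoeff fun ω γ => by rw [hA', hB']
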